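/- Let $\mathcal{H}^2_0$ be the Hilbert space of Dirichlet series $f(s)=\sum_{n\ge 2}a_n n^{-s}$ with complex coefficients and $\|f\|^2=\sum_{n\ge2}|a_n|^2<\infty$; every such series converges absolutely for $\operatorname{Re}s>1/2$. Let $\zeta$ be the Riemann zeta function. For every $f\in\mathcal{H}^2_0$ and every complex $s$ with $\operatorname{Re}s>1/2$ the integral $$\mathbf{H}f(s)=\int_{1/2}^{\infty}f(w)\,(\zeta(w+s)-1)\,dw$$ converges absolutely, and it defines a bounded linear operator $\mathbf{H}$ on $\mathcal{H}^2_0$. On coefficient sequences $\mathbf{H}$ acts as the multiplicative Hilbert matrix on $\ell^2(\{2,3,\dots\})$: if $f(s)=\sum_{n\ge2}a_nn^{-s}$ and $\mathbf{H}f(s)=\sum_{m\ge2}b_mm^{-s}$, then $$b_m=\sum_{n\ge2}\frac{a_n}{\sqrt{mn}\,\log(mn)}\qquad(m\ge2),$$ where the sums converge absolutely. The operator $\mathbf{H}$ is self-adjoint and strictly positive, that is, $\langle\mathbf{H}f,f\rangle>0$ for every $f\ne0$. Its norm is $\|\mathbf{H}\|=\pi$. It has no eigenvalues. Its spectrum is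 the interval $[0,\pi]$ and is purely continuous: the set of $\lambda\in\mathbb{C}$ for which $\mathbf{H}-\lambda$ is injective with dense range but not surjective is also exactly $[0,\pi]$. -/

import Mathlib

open MeasureTheory Set
open scoped InnerProductSpace

/-- The index set `{2, 3, 4, …}`. -/
abbrev IndexTwo : Type := {n : ℕ // 2 ≤ n}

/-- The Hilbert space of Dirichlet series `∑_{n ≥ 2} a_n n^{-s}` with square-summable complex
coefficients: such a series is given by its coefficient sequence, and its norm is the `ℓ²` norm of
the coefficients. -/
abbrev DirichletH20 : Type := lp (fun _ : IndexTwo => ℂ) 2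

namespace DirichletH20

/-- The value `f(s) = ∑_{n ≥ 2} a_n n^{-s}` of the Dirichlet series at `s`. -/
noncomputable def eval (f : DirichletH20) (s : ℂ) : ℂ :=
  ∑' n : IndexTwo, f n * ((n : ℕ) : ℂ) ^ (-s)

/-- The Dirichlet series of `f` converges absolutely in the half-plane `Re s > 1/2`, so `eval`
takes no junk value there. -/
theorem summable_eval (f : DirichletH20) {s : ℂ} (hs : 1 / 2 < s.re) :
    Summable fun n : IndexTwo => f n * ((n : ℕ) : ℂ) ^ (-s) := by
  have h1 : Summable fun n : IndexTwo => ‖f n‖ ^ 2 := by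
    have := (lp.memℓp f).summable (by norm_num)
    simpa using this
  have h2 : Summable fun n : IndexTwo => ((n : ℕ) : ℝ) ^ (-(2 * s.re)) :=
    (Real.summable_nat_rpow.2 (by linarith)).comp_injective Subtype.val_injective
  refine Summable.of_norm_bounded (h1.add h2) fun n => ?_
  have hn : 0 < (n : ℕ) := lt_of_lt_of_le two_pos n.2
  have hn' : (0 : ℝ) < ((n : ℕ) : ℝ) := by exact_mod_cast hn
  have e : ((n : ℕ) : ℝ) ^ (-(2 * s.re)) = (((n : ℕ) : ℝ) ^ (-s.re)) ^ 2 := by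
    rw [← Real.rpow_natCast, ← Real.rpow_mul hn'.le]
    congr 1
    push_cast
    ring
  rw [norm_mul, Complex.norm_natCast_cpow_of_pos hn, Complex.neg_re, e]
  nlinarith [sq_nonneg (‖f n‖ - ((n : ℕ) : ℝ) ^ (-s.re)), norm_nonneg (f n),
    Real.rpow_nonneg hn'.le (-s.re), mul_nonneg (norm_nonneg (f n))
      (Real.rpow_nonneg hn'.le (-s.re))]

/-- A Dirichlet series in the space is determined by the function it represents in the half-plane
`Re s > 1/2`, so the coefficient sequences may be identified with these functions. -/
theorem ext_of_eval (f g : DirichletH20)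
    (h : ∀ s : ℂ, 1 / 2 < s.re → eval f s = eval g s) : f = g := by
  let c : DirichletH20 → ℕ → ℂ := fun f n => if h : 2 ≤ n then f ⟨n, h⟩ else 0
  have term_eq : ∀ (f : DirichletH20) (s : ℂ) (n : IndexTwo),
      LSeries.term (c f) s n = f n * ((n : ℕ) : ℂ) ^ (-s) := by
    intro f s n
    have hn : (n : ℕ) ≠ 0 := (lt_of_lt_of_le two_pos n.2).ne'
    rw [LSeries.term_of_ne_zero hn, Complex.cpow_neg, div_eq_mul_inv]
    simp [c, n.2]
  have supp : ∀ (f : DirichletH20) (s : ℂ),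
      Function.support (LSeries.term (c f) s) ⊆ {n : ℕ | 2 ≤ n} := by
    intro f s n hn
    by_contra h'
    refine hn ?_
    have h' : ¬ 2 ≤ n := h'
    rcases eq_or_ne n 0 with rfl | h0
    · simp
    · rw [LSeries.term_of_ne_zero h0]
      simp [c, h']
  have L : ∀ (f : DirichletH20) (s : ℂ), LSeries (c f) s = eval f s := by
    intro f s
    rw [LSeries, ← tsum_subtype_eq_of_support_subset (supp f s)]
    exact tsum_congr fun n => term_eq f s n
  have S : ∀ f : DirichletH20, LSeries.abscissaOfAbsConv (c f) < ⊤ := by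
    intro f
    have hs : LSeriesSummable (c f) 1 := by
      have := summable_eval f (s := 1) (by norm_num)
      rw [LSeriesSummable, ← Set.indicator_eq_self.2 (supp f 1), ← summable_subtype_iff_indicator]
      exact this.congr fun n => (term_eq f 1 n).symm
    exact lt_of_le_of_lt hs.abscissaOfAbsConv_le (EReal.coe_lt_top _)
  ext n
  have hn : (n : ℕ) ≠ 0 := (lt_of_lt_of_le two_pos n.2).ne'
  have key := LSeries.eq_of_LSeries_eventually_eq (S f) (S g)
    (by
      filter_upwards [Filter.eventually_gt_atTop (1 : ℝ)] with x hx
      rw [L, L]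
      exact h x (by rw [Complex.ofReal_re]; linarith)) hn
  simpa [c, n.2] using key

end DirichletH20

/-- The integrand `w ↦ f(w) (ζ(w + s) - 1)` of the integral operator, for real `w`. -/
noncomputable def zetaIntegrand (f : DirichletH20) (s : ℂ) (w : ℝ) : ℂ :=
  DirichletH20.eval f (w : ℂ) * (riemannZeta ((w : ℂ) + s) - 1)

/-- The multiplicative Hilbert matrix `(1 / (√(mn) log(mn)))_{m, n ≥ 2}`. -/
noncomputable def multHilbertMatrix : Matrix IndexTwo IndexTwo ℝ :=
  Matrix.of fun m n =>
    1 / (Real.sqrt (((m : ℕ) : ℝ) * ((n : ℕ) : ℝ)) *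
      Real.log (((m : ℕ) : ℝ) * ((n : ℕ) : ℝ)))

/-- The continuous spectrum of a bounded operator `T`: the complex numbers `z` for which `T - z`
is injective with dense range but not surjective. -/
def continuousSpectrum {E : Type*} [NormedAddCommGroup E] [NormedSpace ℂ E]
    (T : E →L[ℂ] E) : Set ℂ :=
  {z | Function.Injective (T - z • ContinuousLinearMap.id ℂ E) ∧
    DenseRange (T - z • ContinuousLinearMap.id ℂ E) ∧
    ¬ Function.Surjective (T - z • ContinuousLinearMap.id ℂ E)}

/-! Write `n^{-1/2}` times a function of `log n`. In the variable `x = log n` the matrix becomes a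
discretisation of the Carleman kernel `1/(x+y)` on `(0, ∞)`. That kernel multiplies `x^{w-1}` by `π
/ sin (π w)`, and on the line `Re w = 1/2` this factor is `π / cosh (π β)`, which sweeps out `(0,
π]`.

Upper bound: the Schur test with the weight `1/√(n log n)`, the case `w = 1/2`, has the sharp
constant `π`, because `∫_0^∞ dx / ((x+y)√x) = π/√y` (`schur_test`,
`tsum_inv_mul_log_add_mul_sqrt_log_le`). Positivity: the matrix is the Gram matrix of the functions
`n^{-w}` in `L²(1/2, ∞)`, so the quadratic form is `∫ |f(w)|² dw`, which vanishes only for `f = 0`.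
The same Gram identity, applied to the sequence `n^{-s}`, gives the integral with `ζ(w+s) - 1`.

Spectrum: Euler summation (`TameAmplitude.hasSum_mellin`) replaces sums over `log n` by Mellin
transforms, with an error holomorphic in `Re w > 0`. Hence `(log n)^{w-1}/√n` is an eigenvector up
to a bounded error, while its norm tends to infinity as `Re w` increases to `1/2`. So every `π /
cosh (π β)` lies in the spectrum.

No eigenvalues: let `H f = l f` with `0 < l ≤ π`, and let `N(x) = ∑ a_n / (√n (x + log n))`, so that
`N(log m) = l √m a_m`. Its Mellin transform `M` satisfies `(l sin (π w) - π) M(w) = π E(w)` with `E`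
holomorphic. In `0 < Re w < 5/2` the zeros of the factor lie on `Re w = 1/2`, and there
Cauchy–Schwarz makes `M` too small to have a pole. Shifting the inversion integral to `Re w = 2`
gives `N(y) = O(y^{-2})`. Thus `g = (a_n log n)` is square-summable and `∑ a_n/√n = lim y N(y) = 0`.
Since `log m + log n` cancels the denominator of the matrix, `H g + (log m)(H f)_m = 0`, that is `H
g = -l g`. Positivity forces `g = 0`, hence `f = 0`. At `0` strict positivity itself excludes an
eigenvector. -/

/-! ### The index set and integral tests for logarithmic sums -/

/-- The shift `k ↦ k + 2` as an equivalence of `ℕ` with `{2, 3, …}`. -/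
def IndexTwo.natEquiv : ℕ ≃ IndexTwo where
  toFun k := ⟨k + 2, by omega⟩
  invFun n := (n : ℕ) - 2
  left_inv k := by simp
  right_inv n := by
    have := n.2
    ext
    simp only
    omega

namespace IndexTwo

theorem pos (n : IndexTwo) : 0 < ((n : ℕ) : ℝ) := by
  have := n.2
  positivity

theorem two_le (n : IndexTwo) : (2 : ℝ) ≤ ((n : ℕ) : ℝ) := by exact_mod_cast n.2

theorem log_two_le (n : IndexTwo) : Real.log 2 ≤ Real.log (n : ℕ) :=
  Real.log_le_log two_pos n.two_le

theorem log_pos (n : IndexTwo) : 0 < Real.log (n : ℕ) :=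
  (Real.log_pos one_lt_two).trans_le n.log_two_le

theorem half_le_log (n : IndexTwo) : 1 / 2 ≤ Real.log (n : ℕ) := by
  linarith [n.log_two_le, Real.log_two_gt_d9]

end IndexTwo

/-- A nonnegative sequence dominated by the increments of a bounded sequence is summable. -/
theorem summable_and_tsum_le_of_telescoping {c G : ℕ → ℝ} {B : ℝ} (hc : ∀ k, 0 ≤ c k)
    (h : ∀ k, c k ≤ G (k + 1) - G k) (hG : ∀ k, G k ≤ B) :
    Summable c ∧ ∑' k, c k ≤ B - G 0 := by
  have h1 : ∀ n, ∑ k ∈ Finset.range n, c k ≤ B - G 0 := fun n =>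
    calc ∑ k ∈ Finset.range n, c k ≤ ∑ k ∈ Finset.range n, (G (k + 1) - G k) :=
          Finset.sum_le_sum fun k _ => h k
      _ = G n - G 0 := Finset.sum_range_sub _ _
      _ ≤ B - G 0 := by linarith [hG n]
  exact ⟨summable_of_sum_range_le hc h1, Real.tsum_le_of_sum_range_le hc h1⟩

/-- The substitution `v = √(log u / y)` turns the integrand into `2 / (√y (1 + v²))`. The total
variation of this primitive over `(1, ∞)` is exactly `π/√y`, the source of the sharp constant `π`.
-/
theorem hasDerivAt_arctan_sqrt_log {y u : ℝ} (hy : 0 < y) (hu : 1 < u) :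
    HasDerivAt (fun u => 2 / √y * Real.arctan (√(Real.log u / y)))
      (1 / (u * (Real.log u + y) * √(Real.log u))) u := by
  have hl : 0 < Real.log u := Real.log_pos hu
  have hu0 : 0 < u := by linarith
  have h := ((((Real.hasDerivAt_log hu0.ne').div_const y).sqrt (by positivity)).arctan).const_mul
    (2 / √y)
  refine h.congr_deriv ?_
  rw [Real.sqrt_div hl.le, div_pow, Real.sq_sqrt hl.le, Real.sq_sqrt hy.le]
  have hy2 : √y * √y = y := Real.mul_self_sqrt hy.le
  have : 0 < √y := by positivity
  have : 0 < √(Real.log u) := by positivity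
  field_simp
  nlinarith

/-- The integral-test bound behind the Schur test for the multiplicative Hilbert matrix. -/
theorem tsum_inv_mul_log_add_mul_sqrt_log_le {y : ℝ} (hy : 0 < y) :
    (Summable fun n : IndexTwo =>
      1 / (((n : ℕ) : ℝ) * (Real.log (n : ℕ) + y) * √(Real.log (n : ℕ)))) ∧
    ∑' n : IndexTwo, 1 / (((n : ℕ) : ℝ) * (Real.log (n : ℕ) + y) * √(Real.log (n : ℕ)))
      ≤ Real.pi / √y := by
  set q : ℝ → ℝ := fun u => 1 / (u * (Real.log u + y) * √(Real.log u)) with hq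
  set P : ℝ → ℝ := fun u => 2 / √y * Real.arctan (√(Real.log u / y)) with hP
  have key := summable_and_tsum_le_of_telescoping (c := fun k : ℕ => q ((k : ℝ) + 2))
    (G := fun k : ℕ => P ((k : ℝ) + 1)) (B := Real.pi / √y) (fun k => by
      have : 0 ≤ Real.log ((k : ℝ) + 2) := Real.log_nonneg (by linarith [k.cast_nonneg (α := ℝ)])
      positivity) (fun k => by
      have hk : (0 : ℝ) ≤ k := k.cast_nonneg
      -- For `k = 0` the interval starts at `1`, where `log` vanishes and the derivative blows up.
      -- The mean value theorem only needs continuity there.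
      have hcont : ContinuousOn P (Icc ((k : ℝ) + 1) (k + 2)) := by
        refine continuousOn_const.mul (Real.continuous_arctan.comp_continuousOn
          (ContinuousOn.sqrt ((Real.continuousOn_log.mono fun x hx => ?_).div_const y)))
        have : x ≠ 0 := by linarith [hx.1]
        simpa using this
      obtain ⟨ξ, hξ, hs⟩ := exists_hasDerivAt_eq_slope P q (by linarith) hcont
        fun x hx => hasDerivAt_arctan_sqrt_log hy (by linarith [hx.1])
      have e : P ((↑(k + 1) : ℝ) + 1) - P (k + 1) = q ξ := by
        rw [hs]
        push_cast
        rw [show (k : ℝ) + 1 + 1 = k + 2 by ring]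
        rw [show (k : ℝ) + 2 - (k + 1) = 1 by ring, div_one]
      rw [e]
      have hl : 0 < Real.log ξ := Real.log_pos (by linarith [hξ.1])
      have hll : Real.log ξ ≤ Real.log (k + 2) := Real.log_le_log (by linarith [hξ.1]) hξ.2.le
      have h1 : 0 < ξ := by linarith [hξ.1]
      have h2 := hξ.2.le
      have h3 : 0 < Real.log ((k : ℝ) + 2) := by linarith
      simp only [hq]
      gcongr) (fun k => by
      have := Real.arctan_lt_pi_div_two (√(Real.log ((k : ℝ) + 1) / y))
      calc P ((k : ℝ) + 1) ≤ 2 / √y * (Real.pi / 2) := by simp only [hP]; gcongr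
        _ = Real.pi / √y := by ring)
  simp only [hP, Nat.cast_zero, zero_add, Real.log_one, zero_div, Real.sqrt_zero,
    Real.arctan_zero, mul_zero, sub_zero] at key
  have e : (fun k : ℕ => q ((k : ℝ) + 2)) = (fun n : IndexTwo => q (n : ℕ)) ∘ IndexTwo.natEquiv := by
    ext k
    simp [IndexTwo.natEquiv]
  refine ⟨?_, ?_⟩
  · rw [e] at key
    exact (IndexTwo.natEquiv.summable_iff).1 key.1
  · rw [← IndexTwo.natEquiv.tsum_eq (fun n : IndexTwo => q (n : ℕ))]
    refine le_trans (le_of_eq (tsum_congr fun k => ?_)) key.2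
    exact (congrFun e k).symm

/-- The integral-test bound for `∑ (log n)^{-1-2δ} / n`, with its blow-up rate as `δ → 0`. -/
theorem tsum_log_rpow_div_le {δ : ℝ} (hδ : 0 < δ) (hδ1 : δ ≤ 1) :
    (Summable fun n : IndexTwo => Real.log (n : ℕ) ^ (-1 - 2 * δ) / ((n : ℕ) : ℝ)) ∧
    ∑' n : IndexTwo, Real.log (n : ℕ) ^ (-1 - 2 * δ) / ((n : ℕ) : ℝ) ≤ 6 / δ := by
  set q : ℝ → ℝ := fun u => Real.log u ^ (-1 - 2 * δ) / u with hq
  set P : ℝ → ℝ := fun u => -(Real.log u ^ (-(2 * δ)) / (2 * δ)) with hP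
  have hq0 : ∀ k : ℕ, 0 ≤ q ((k : ℝ) + 2) := fun k => by
    have : 0 ≤ Real.log ((k : ℝ) + 2) := Real.log_nonneg (by linarith [k.cast_nonneg (α := ℝ)])
    positivity
  have hder : ∀ x : ℝ, 1 < x → HasDerivAt P (q x) x := fun x hx => by
    have hl : 0 < Real.log x := Real.log_pos hx
    have h := ((((Real.hasDerivAt_log (by linarith : x ≠ 0)).rpow_const (p := -(2 * δ))
      (Or.inl hl.ne')).div_const (2 * δ))).neg
    refine h.congr_deriv ?_
    simp only [hq]
    rw [show -1 - 2 * δ = -(2 * δ) - 1 by ring]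
    field_simp
  -- The integrand is not integrable at `u = 1`, so the comparison starts with the term `n = 3` and
  -- the term `n = 2` is estimated separately.
  have key := summable_and_tsum_le_of_telescoping (c := fun k : ℕ => q ((k : ℝ) + 1 + 2))
    (G := fun k : ℕ => P ((k : ℝ) + 2)) (B := 0) (fun k => by exact_mod_cast hq0 (k + 1)) (fun k => by
      have hk : (0 : ℝ) ≤ k := k.cast_nonneg
      obtain ⟨ξ, hξ, hs⟩ := exists_hasDerivAt_eq_slope P q
        (show (k : ℝ) + 2 < k + 1 + 2 by linarith)
        (fun x hx => (hder x (by linarith [hx.1])).continuousAt.continuousWithinAt)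
        fun x hx => hder x (by linarith [hx.1])
      have e : P ((↑(k + 1) : ℝ) + 2) - P (k + 2) = q ξ := by
        rw [hs]
        push_cast
        rw [show (k : ℝ) + 1 + 2 - (k + 2) = 1 by ring, div_one]
      rw [e]
      have h1 : 0 < ξ := by linarith [hξ.1]
      have hl : 0 < Real.log ξ := Real.log_pos (by linarith [hξ.1])
      have hll : Real.log ξ ≤ Real.log (k + 1 + 2) := Real.log_le_log h1 hξ.2.le
      have h2 := hξ.2.le
      simp only [hq]
      exact div_le_div₀ (by positivity)
        (Real.rpow_le_rpow_of_nonpos hl hll (by linarith)) h1 h2) (fun k => by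
      have : 0 ≤ Real.log ((k : ℝ) + 2) := Real.log_nonneg (by linarith [k.cast_nonneg (α := ℝ)])
      simp only [hP]
      rw [neg_nonpos]
      positivity)
  have hs : Summable fun k : ℕ => q ((k : ℝ) + 2) := by
    rw [← summable_nat_add_iff 1]
    simpa using key.1
  have e : (fun k : ℕ => q ((k : ℝ) + 2)) = (fun n : IndexTwo => q (n : ℕ)) ∘ IndexTwo.natEquiv := by
    ext k
    simp [IndexTwo.natEquiv]
  refine ⟨(IndexTwo.natEquiv.summable_iff).1 (e ▸ hs), ?_⟩
  have e2 : ∑' n : IndexTwo, q (n : ℕ) = ∑' k : ℕ, q ((k : ℝ) + 2) := by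
    rw [← IndexTwo.natEquiv.tsum_eq (fun n : IndexTwo => q (n : ℕ))]
    exact tsum_congr fun k => (congrFun e k).symm
  change ∑' n : IndexTwo, q (n : ℕ) ≤ _
  rw [e2, hs.tsum_eq_zero_add]
  have hl2 : (1 / 2 : ℝ) ≤ Real.log 2 := by linarith [Real.log_two_gt_d9]
  have b : ∀ a : ℝ, 0 ≤ a → a ≤ 3 → Real.log 2 ^ (-a) ≤ 8 := fun a ha ha3 => by
    calc Real.log 2 ^ (-a) ≤ (1 / 2 : ℝ) ^ (-a) :=
          Real.rpow_le_rpow_of_nonpos (by norm_num) hl2 (by linarith)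
      _ = 2 ^ a := by rw [one_div, Real.inv_rpow two_pos.le, Real.rpow_neg two_pos.le, inv_inv]
      _ ≤ 2 ^ (3 : ℝ) := Real.rpow_le_rpow_of_exponent_le one_le_two ha3
      _ = 8 := by norm_num
  have b' : Real.log 2 ^ (-(2 * δ)) ≤ 4 := by
    calc Real.log 2 ^ (-(2 * δ)) ≤ (1 / 2 : ℝ) ^ (-(2 * δ)) :=
          Real.rpow_le_rpow_of_nonpos (by norm_num) hl2 (by linarith)
      _ = 2 ^ (2 * δ) := by rw [one_div, Real.inv_rpow two_pos.le, Real.rpow_neg two_pos.le, inv_inv]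
      _ ≤ 2 ^ (2 : ℝ) := Real.rpow_le_rpow_of_exponent_le one_le_two (by linarith)
      _ = 4 := by norm_num
  have h0 : q (0 + 2) ≤ 4 / δ := by
    have := b (1 + 2 * δ) (by linarith) (by linarith)
    rw [show -(1 + 2 * δ) = -1 - 2 * δ by ring] at this
    have h1 : q (0 + 2) ≤ 4 := by
      simp only [hq, zero_add]
      linarith
    refine h1.trans ?_
    rw [le_div_iff₀ hδ]
    linarith
  have h1 : 0 - P (0 + 2) ≤ 2 / δ := by
    simp only [hP, zero_add, zero_sub, neg_neg]
    rw [div_le_div_iff₀ (by positivity) hδ]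
    nlinarith
  have h2 := key.2
  simp only [Nat.cast_zero, Nat.cast_add, Nat.cast_one] at h2 ⊢
  calc _ ≤ 4 / δ + 2 / δ := add_le_add h0 (h2.trans h1)
    _ = 6 / δ := by ring

/-- The primitive `log log u` is unbounded. This series is the termwise limit of `∑ (log
n)^{-1-2δ}/n` as `δ → 0`, so its divergence makes the approximate eigenvectors blow up. -/
theorem not_summable_inv_mul_log :
    ¬ Summable fun n : IndexTwo => 1 / (((n : ℕ) : ℝ) * Real.log (n : ℕ)) := by
  intro h
  set P : ℝ → ℝ := fun u => Real.log (Real.log u) with hP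
  have hs : Summable fun k : ℕ => 1 / (((k : ℝ) + 2) * Real.log ((k : ℝ) + 2)) := by
    have := (IndexTwo.natEquiv.summable_iff).2 h
    refine this.congr fun k => ?_
    simp [IndexTwo.natEquiv]
  have step : ∀ k : ℕ, P ((↑(k + 1) : ℝ) + 2) - P ((k : ℝ) + 2) ≤
      1 / (((k : ℝ) + 2) * Real.log ((k : ℝ) + 2)) := fun k => by
    have hk : (0 : ℝ) ≤ k := k.cast_nonneg
    have hder : ∀ x : ℝ, 1 < x → HasDerivAt P (x⁻¹ / Real.log x) x := fun x hx =>
      (Real.hasDerivAt_log (by linarith : x ≠ 0)).log (Real.log_pos hx).ne'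
    obtain ⟨ξ, hξ, hs⟩ := exists_hasDerivAt_eq_slope P (fun x => x⁻¹ / Real.log x)
      (show (k : ℝ) + 2 < k + 1 + 2 by linarith)
      (fun x hx => (hder x (by linarith [hx.1])).continuousAt.continuousWithinAt)
      fun x hx => hder x (by linarith [hx.1])
    rw [show (k : ℝ) + 1 + 2 - (k + 2) = 1 by ring, div_one] at hs
    push_cast
    rw [← hs, inv_eq_one_div, div_div]
    have hl : 0 < Real.log ((k : ℝ) + 2) := Real.log_pos (by linarith)
    have := Real.log_le_log (by linarith) hξ.1.le
    have h1 := hξ.1.le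
    have h2 : 0 < ξ := by linarith
    gcongr
  have hb : ∀ n : ℕ, P ((n : ℝ) + 2) - P ((0 : ℕ) + 2) ≤
      ∑' k : ℕ, 1 / (((k : ℝ) + 2) * Real.log ((k : ℝ) + 2)) := fun n => by
    rw [← Finset.sum_range_sub (fun k : ℕ => P ((k : ℝ) + 2))]
    refine (Finset.sum_le_sum fun k _ => step k).trans (hs.sum_le_tsum _ fun k _ => ?_)
    have : 0 ≤ Real.log ((k : ℝ) + 2) := Real.log_nonneg (by linarith [k.cast_nonneg (α := ℝ)])
    positivity
  have ht : Filter.Tendsto (fun n : ℕ => P ((n : ℝ) + 2)) Filter.atTop Filter.atTop :=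
    Real.tendsto_log_atTop.comp (Real.tendsto_log_atTop.comp
      (Filter.tendsto_atTop_add_const_right _ _ tendsto_natCast_atTop_atTop))
  obtain ⟨n, hn⟩ := (ht.eventually_gt_atTop
    (∑' k : ℕ, 1 / (((k : ℝ) + 2) * Real.log ((k : ℝ) + 2)) + P ((0 : ℕ) + 2))).exists
  linarith [hb n]

/-! ### The Schur test and the bound `π` for the matrix -/

/-- The Cauchy–Schwarz inequality for a series with terms `r i`, `r i ^ 2 = f i * g i`. -/
theorem summable_and_tsum_sq_le_of_sq_eq_mul {ι : Type*} {r f g : ι → ℝ} (hr : ∀ i, 0 ≤ r i)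
    (hf : ∀ i, 0 ≤ f i) (hg : ∀ i, 0 ≤ g i) (h : ∀ i, r i ^ 2 = f i * g i)
    (hsf : Summable f) (hsg : Summable g) :
    Summable r ∧ (∑' i, r i) ^ 2 ≤ (∑' i, f i) * ∑' i, g i := by
  have hs : Summable r := by
    refine Summable.of_nonneg_of_le hr (fun i => ?_) (hsf.add hsg)
    nlinarith [sq_nonneg (f i - g i), h i, hf i, hg i, hr i]
  refine ⟨hs, ?_⟩
  have h1 : Filter.Tendsto (fun s : Finset ι => (∑ i ∈ s, r i) ^ 2) Filter.atTop
      (nhds ((∑' i, r i) ^ 2)) := hs.hasSum.pow 2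
  refine le_of_tendsto' h1 fun s => ?_
  refine (Finset.sum_sq_le_sum_mul_sum_of_sq_le_mul s (fun i _ => hf i)
    (fun i _ => hg i) fun i _ => (h i).le).trans ?_
  exact mul_le_mul (hsf.sum_le_tsum _ fun i _ => hf i) (hsg.sum_le_tsum _ fun i _ => hg i)
    (Finset.sum_nonneg fun i _ => hg i) (tsum_nonneg hf)

/-- The Schur test on nonnegative sequences. -/
theorem schur_test_real {ι : Type*} {K : ι → ι → ℝ} (hK : ∀ m n, 0 ≤ K m n)
    (hsymm : ∀ m n, K m n = K n m) {w : ι → ℝ} (hw : ∀ n, 0 < w n) {C : ℝ} (hC : 0 ≤ C)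
    (hs : ∀ m, Summable fun n => K m n * w n) (hb : ∀ m, ∑' n, K m n * w n ≤ C * w m)
    {a : ι → ℝ} (ha : ∀ n, 0 ≤ a n) (ha2 : Summable fun n => a n ^ 2) :
    (∀ m, Summable fun n => K m n * a n) ∧ (Summable fun m => (∑' n, K m n * a n) ^ 2) ∧
      ∑' m, (∑' n, K m n * a n) ^ 2 ≤ C ^ 2 * ∑' n, a n ^ 2 := by
  -- Cauchy–Schwarz is applied to `K a = √(K w) · √(K a² / w)`. Up to the factor `w m`, `G (n, m)`
  -- is the square of the second factor, arranged so that summing over `m` first uses the hypothesis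
  -- on `K w` once more.
  set G : ι × ι → ℝ := fun p => a p.1 ^ 2 / w p.1 * (K p.1 p.2 * w p.2) with hG
  have hG0 : ∀ p, 0 ≤ G p := fun p => by
    have := (hw p.1).le
    have := (hw p.2).le
    have := hK p.1 p.2
    positivity
  have hrow : ∀ n, ∑' m, G (n, m) ≤ C * a n ^ 2 := fun n => by
    simp only [hG]
    rw [tsum_mul_left]
    calc a n ^ 2 / w n * ∑' m, K n m * w m ≤ a n ^ 2 / w n * (C * w n) := by
          have := (hw n).le
          gcongr
          exact hb n
      _ = C * a n ^ 2 := by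
          have := (hw n).ne'
          field_simp
  have hGs : Summable G := by
    rw [summable_prod_of_nonneg hG0]
    refine ⟨fun n => (hs n).mul_left (a n ^ 2 / w n), ?_⟩
    exact Summable.of_nonneg_of_le (fun n => tsum_nonneg fun m => hG0 _) hrow (ha2.mul_left C)
  have hGs' : Summable fun p : ι × ι => G p.swap := 
    hGs.comp_injective Prod.swap_injective
  have hcol : ∀ m, Summable fun n => G (n, m) := fun m => hGs'.prod_factor m
  have hcol0 : Summable fun m => ∑' n, G (n, m) := hGs'.prod
  have htot : ∑' m, ∑' n, G (n, m) ≤ C * ∑' n, a n ^ 2 := by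
    have h1 : ∑' m, ∑' n, G (n, m) = ∑' n, ∑' m, G (n, m) :=
      Summable.tsum_comm (f := fun n m => G (n, m)) hGs
    rw [h1, ← tsum_mul_left]
    exact hGs.prod.tsum_le_tsum hrow (ha2.mul_left C)
  have hCS : ∀ m, (Summable fun n => K m n * a n) ∧
      (∑' n, K m n * a n) ^ 2 ≤ C * ∑' n, G (n, m) := fun m => by
    have hm := hw m
    have hsg : Summable fun n => G (n, m) / w m := (hcol m).div_const _
    obtain ⟨h1, h2⟩ := summable_and_tsum_sq_le_of_sq_eq_mul
      (r := fun n => K m n * a n) (f := fun n => K m n * w n) (g := fun n => G (n, m) / w m)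
      (fun n => mul_nonneg (hK m n) (ha n)) (fun n => mul_nonneg (hK m n) (hw n).le)
      (fun n => div_nonneg (hG0 _) hm.le) (fun n => by
        have := (hw n).ne'
        simp only [hG, hsymm n m]
        field_simp) (hs m) hsg
    refine ⟨h1, h2.trans ?_⟩
    rw [tsum_div_const]
    calc (∑' n, K m n * w n) * ((∑' n, G (n, m)) / w m)
        ≤ (C * w m) * ((∑' n, G (n, m)) / w m) :=
          mul_le_mul_of_nonneg_right (hb m) (div_nonneg (tsum_nonneg fun n => hG0 _) hm.le)
      _ = C * ∑' n, G (n, m) := by field_simp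
  have hS : Summable fun m => (∑' n, K m n * a n) ^ 2 :=
    Summable.of_nonneg_of_le (fun m => sq_nonneg _) (fun m => (hCS m).2) (hcol0.mul_left C)
  refine ⟨fun m => (hCS m).1, hS, ?_⟩
  calc ∑' m, (∑' n, K m n * a n) ^ 2 ≤ ∑' m, C * ∑' n, G (n, m) :=
        hS.tsum_le_tsum (fun m => (hCS m).2) (hcol0.mul_left C)
    _ = C * ∑' m, ∑' n, G (n, m) := tsum_mul_left
    _ ≤ C * (C * ∑' n, a n ^ 2) := mul_le_mul_of_nonneg_left htot hC
    _ = C ^ 2 * ∑' n, a n ^ 2 := by ring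

theorem lp_two_summable_sq {ι : Type*} (f : lp (fun _ : ι => ℂ) 2) :
    Summable fun n => ‖f n‖ ^ 2 := by
  have := (lp.memℓp f).summable (by norm_num)
  simpa using this

theorem lp_two_norm_sq {ι : Type*} (f : lp (fun _ : ι => ℂ) 2) :
    ‖f‖ ^ 2 = ∑' n, ‖f n‖ ^ 2 := by
  have := lp.norm_rpow_eq_tsum (p := 2) (by norm_num) f
  simpa using this

theorem memℓp_two_of_summable_sq {ι : Type*} {f : ι → ℂ} (h : Summable fun n => ‖f n‖ ^ 2) :
    Memℓp f 2 := by
  refine memℓp_gen ?_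
  simpa using h

/-- The Schur test: a nonnegative symmetric matrix with a positive weight `w` such that
`K w ≤ C w` acts boundedly on `ℓ²` with norm at most `C`. -/
theorem schur_test {ι : Type*} {K : ι → ι → ℝ} (hK : ∀ m n, 0 ≤ K m n)
    (hsymm : ∀ m n, K m n = K n m) {w : ι → ℝ} (hw : ∀ n, 0 < w n) {C : ℝ} (hC : 0 ≤ C)
    (hs : ∀ m, Summable fun n => K m n * w n) (hb : ∀ m, ∑' n, K m n * w n ≤ C * w m) :
    ∃ T : lp (fun _ : ι => ℂ) 2 →L[ℂ] lp (fun _ : ι => ℂ) 2, ‖T‖ ≤ C ∧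
      ∀ f m, HasSum (fun n => (K m n : ℂ) * f n) (T f m) := by
  have hnorm : ∀ (f : lp (fun _ : ι => ℂ) 2) m n, ‖(K m n : ℂ) * f n‖ = K m n * ‖f n‖ :=
    fun f m n => by rw [norm_mul, Complex.norm_real, Real.norm_of_nonneg (hK m n)]
  have core := fun f : lp (fun _ : ι => ℂ) 2 => schur_test_real hK hsymm hw hC hs hb
    (a := fun n => ‖f n‖) (fun n => norm_nonneg _) (lp_two_summable_sq f)
  have hsum : ∀ (f : lp (fun _ : ι => ℂ) 2) m, Summable fun n => (K m n : ℂ) * f n :=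
    fun f m => Summable.of_norm (((core f).1 m).congr fun n => (hnorm f m n).symm)
  have hle : ∀ (f : lp (fun _ : ι => ℂ) 2) m,
      ‖∑' n, (K m n : ℂ) * f n‖ ≤ ∑' n, K m n * ‖f n‖ := fun f m => by
    refine (norm_tsum_le_tsum_norm (hsum f m).norm).trans (le_of_eq ?_)
    exact tsum_congr fun n => hnorm f m n
  have hsq : ∀ (f : lp (fun _ : ι => ℂ) 2) m,
      ‖∑' n, (K m n : ℂ) * f n‖ ^ 2 ≤ (∑' n, K m n * ‖f n‖) ^ 2 := fun f m =>
    pow_le_pow_left₀ (norm_nonneg _) (hle f m) 2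
  have hs2 : ∀ f : lp (fun _ : ι => ℂ) 2, Summable fun m => ‖∑' n, (K m n : ℂ) * f n‖ ^ 2 :=
    fun f => Summable.of_nonneg_of_le (fun m => sq_nonneg _) (hsq f) (core f).2.1
  let T₀ : lp (fun _ : ι => ℂ) 2 →ₗ[ℂ] lp (fun _ : ι => ℂ) 2 :=
    { toFun := fun f => ⟨fun m => ∑' n, (K m n : ℂ) * f n, memℓp_two_of_summable_sq (hs2 f)⟩
      map_add' := fun f g => by
        ext m
        simp only [lp.coeFn_add, Pi.add_apply, mul_add]
        exact (hsum f m).tsum_add (hsum g m)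
      map_smul' := fun c f => by
        ext m
        simp only [lp.coeFn_smul, Pi.smul_apply, smul_eq_mul, RingHom.id_apply]
        rw [← tsum_mul_left]
        exact tsum_congr fun n => by ring }
  have hT : ∀ f m, T₀ f m = ∑' n, (K m n : ℂ) * f n := fun f m => rfl
  refine ⟨T₀.mkContinuous C fun f => ?_, T₀.mkContinuous_norm_le hC _, fun f m => ?_⟩
  · refine le_of_sq_le_sq ?_ (by positivity)
    rw [mul_pow, lp_two_norm_sq, lp_two_norm_sq]
    refine le_trans ?_ (core f).2.2
    exact (hs2 f).tsum_le_tsum (hsq f) (core f).2.1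
  · exact (hsum f m).hasSum

theorem multHilbertMatrix_nonneg (m n : IndexTwo) : 0 ≤ multHilbertMatrix m n := by
  have h1 := m.two_le
  have h2 := n.two_le
  have : 0 ≤ Real.log (((m : ℕ) : ℝ) * ((n : ℕ) : ℝ)) := Real.log_nonneg (by nlinarith)
  simp only [multHilbertMatrix, Matrix.of_apply]
  positivity

theorem multHilbertMatrix_symm (m n : IndexTwo) :
    multHilbertMatrix m n = multHilbertMatrix n m := by
  simp only [multHilbertMatrix, Matrix.of_apply, mul_comm]

theorem multHilbertMatrix_apply (m n : IndexTwo) :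
    multHilbertMatrix m n =
      1 / (√((m : ℕ) : ℝ) * √((n : ℕ) : ℝ) * (Real.log (n : ℕ) + Real.log (m : ℕ))) := by
  simp only [multHilbertMatrix, Matrix.of_apply]
  rw [Real.sqrt_mul m.pos.le, Real.log_mul m.pos.ne' n.pos.ne', add_comm (Real.log (m : ℕ))]

/-- The weight is the formal eigenvector `(log n)^{w-1}/√n` at `w = 1/2`, where `π / sin (π w) = π`.
This is why the Schur test loses nothing. -/
theorem multHilbertMatrix_mul_weight (m n : IndexTwo) :
    multHilbertMatrix m n * (1 / (√((n : ℕ) : ℝ) * √(Real.log (n : ℕ)))) =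
      1 / √((m : ℕ) : ℝ) *
        (1 / (((n : ℕ) : ℝ) * (Real.log (n : ℕ) + Real.log (m : ℕ)) * √(Real.log (n : ℕ)))) := by
  rw [multHilbertMatrix_apply]
  have e : ((n : ℕ) : ℝ) = √((n : ℕ) : ℝ) * √((n : ℕ) : ℝ) := (Real.mul_self_sqrt n.pos.le).symm
  rw [div_mul_div_comm, div_mul_div_comm]
  congr 1
  linear_combination -(√((m : ℕ) : ℝ) * (Real.log (n : ℕ) + Real.log (m : ℕ)) *
    √(Real.log (n : ℕ))) * e

/-- The multiplicative Hilbert matrix acts boundedly with norm at most `π`. -/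
theorem exists_multHilbertOperator :
    ∃ T : DirichletH20 →L[ℂ] DirichletH20, ‖T‖ ≤ Real.pi ∧
      ∀ f m, HasSum (fun n => (multHilbertMatrix m n : ℂ) * f n) (T f m) := by
  refine schur_test multHilbertMatrix_nonneg multHilbertMatrix_symm
    (w := fun n => 1 / (√((n : ℕ) : ℝ) * √(Real.log (n : ℕ)))) (fun n => ?_) Real.pi_pos.le
    (fun m => ?_) fun m => ?_
  · have := n.pos
    have := n.log_pos
    positivity
  · refine Summable.congr ?_ fun n => (multHilbertMatrix_mul_weight m n).symm
    exact (tsum_inv_mul_log_add_mul_sqrt_log_le m.log_pos).1.mul_left _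
  · rw [tsum_congr fun n => multHilbertMatrix_mul_weight m n, tsum_mul_left]
    calc _ ≤ 1 / √((m : ℕ) : ℝ) * (Real.pi / √(Real.log (m : ℕ))) := by
          gcongr
          exact (tsum_inv_mul_log_add_mul_sqrt_log_le m.log_pos).2
      _ = _ := by rw [div_mul_div_comm, one_mul, mul_one_div]

/-- The operator on `ℓ²({2, 3, …})` given by the multiplicative Hilbert matrix. -/
noncomputable def multHilbertOperator : DirichletH20 →L[ℂ] DirichletH20 :=
  exists_multHilbertOperator.choose

theorem norm_multHilbertOperator_le : ‖multHilbertOperator‖ ≤ Real.pi :=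
  exists_multHilbertOperator.choose_spec.1

theorem hasSum_multHilbertOperator (f : DirichletH20) (m : IndexTwo) :
    HasSum (fun n => (multHilbertMatrix m n : ℂ) * f n) (multHilbertOperator f m) :=
  exists_multHilbertOperator.choose_spec.2 f m

/-! ### The Gram representation, the zeta integral and positivity -/

/-- A series of integrable functions whose `L¹` norms are summable converges almost everywhere to
an integrable function. -/
theorem integrable_tsum_of_summable_integral_norm {α E ι : Type*} [MeasurableSpace α]
    {μ : Measure α} [NormedAddCommGroup E] [CompleteSpace E] [Countable ι] {F : ι → α → E}
    (hF : ∀ i, Integrable (F i) μ) (hs : Summable fun i => ∫ a, ‖F i a‖ ∂μ) :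
    Integrable (fun a => ∑' i, F i a) μ := by
  have hfin : ∫⁻ a, ∑' i, ‖F i a‖ₑ ∂μ < ⊤ := by
    rw [lintegral_tsum fun i => (hF i).1.enorm]
    have h1 : ∀ i, ∫⁻ a, ‖F i a‖ₑ ∂μ = ENNReal.ofReal (∫ a, ‖F i a‖ ∂μ) := fun i =>
      (ofReal_integral_norm_eq_lintegral_enorm (hF i)).symm
    simp_rw [h1]
    exact hs.tsum_ofReal_lt_top
  have hae : ∀ᵐ a ∂μ, Summable fun i => F i a := by
    have h2 := ae_lt_top' (AEMeasurable.tsum fun i => (hF i).1.enorm) hfin.ne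
    filter_upwards [h2] with a ha
    exact Summable.of_nnnorm (ENNReal.tsum_coe_ne_top_iff_summable.1 ha.ne)
  refine ⟨?_, lt_of_le_of_lt (lintegral_mono fun a => ?_) hfin⟩
  · refine aestronglyMeasurable_of_tendsto_ae (Filter.atTop (α := Finset ι))
      (f := fun s a => ∑ i ∈ s, F i a) (fun s => ?_) ?_
    · exact Finset.aestronglyMeasurable_fun_sum s fun i _ => (hF i).1
    · filter_upwards [hae] with a ha
      exact ha.hasSum
  · exact enorm_tsum_le_tsum_enorm

theorem natCast_cpow_neg_ofReal (n : IndexTwo) (w : ℝ) :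
    ((n : ℕ) : ℂ) ^ (-(w : ℂ)) = (Real.exp (-(Real.log (n : ℕ) * w)) : ℝ) := by
  have hn : ((n : ℕ) : ℂ) ≠ 0 := by exact_mod_cast n.pos.ne'
  rw [Complex.cpow_def_of_ne_zero hn, ← Complex.natCast_log]
  push_cast
  ring_nf

theorem exp_mul_exp_integral (m n : IndexTwo) :
    IntegrableOn (fun w : ℝ => Real.exp (-(Real.log (m : ℕ) * w)) *
      Real.exp (-(Real.log (n : ℕ) * w))) (Ioi (1 / 2)) ∧
    ∫ w in Ioi (1 / 2 : ℝ), Real.exp (-(Real.log (m : ℕ) * w)) *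
      Real.exp (-(Real.log (n : ℕ) * w)) = multHilbertMatrix m n := by
  have hL : -(Real.log (n : ℕ) + Real.log (m : ℕ)) < 0 := by linarith [m.log_pos, n.log_pos]
  have e : (fun w : ℝ => Real.exp (-(Real.log (m : ℕ) * w)) * Real.exp (-(Real.log (n : ℕ) * w)))
      = fun w => Real.exp (-(Real.log (n : ℕ) + Real.log (m : ℕ)) * w) := by
    ext w
    rw [← Real.exp_add]
    ring_nf
  rw [e]
  refine ⟨integrableOn_exp_mul_Ioi hL _, ?_⟩
  rw [integral_exp_mul_Ioi hL, multHilbertMatrix_apply]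
  have h : ∀ k : IndexTwo, √((k : ℕ) : ℝ) = Real.exp (Real.log (k : ℕ) / 2) := fun k => by
    rw [Real.sqrt_eq_rpow, Real.rpow_def_of_pos k.pos]
    ring_nf
  rw [h m, h n, ← Real.exp_add, show -(Real.log (n : ℕ) + Real.log (m : ℕ)) * (1 / 2) =
    -(Real.log (m : ℕ) / 2 + Real.log (n : ℕ) / 2) by ring, Real.exp_neg, neg_div_neg_eq]
  field_simp

/-- Products of square-summable sequences with a row image of the matrix are absolutely summable. -/
theorem summable_multHilbertMatrix_mul_norm (f g : DirichletH20) :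
    Summable fun p : IndexTwo × IndexTwo => ‖f p.1‖ * ‖g p.2‖ * multHilbertMatrix p.1 p.2 := by
  -- With the moduli of `g` in place of `g`, the row sums are the coordinates of a vector of `ℓ²`.
  let g' : DirichletH20 := ⟨fun n => (‖g n‖ : ℂ), memℓp_two_of_summable_sq (by
    simpa using lp_two_summable_sq g)⟩
  have h0 : ∀ p : IndexTwo × IndexTwo, 0 ≤ ‖f p.1‖ * ‖g p.2‖ * multHilbertMatrix p.1 p.2 :=
    fun p => mul_nonneg (by positivity) (multHilbertMatrix_nonneg _ _)
  have hg : ∀ m, HasSum (fun n => multHilbertMatrix m n * ‖g n‖) ‖multHilbertOperator g' m‖ := by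
    intro m
    have h1 := hasSum_multHilbertOperator g' m
    have h2 : HasSum (fun n => ((multHilbertMatrix m n * ‖g n‖ : ℝ) : ℂ))
        (multHilbertOperator g' m) := by
      convert h1 using 2 with n
      push_cast
      rfl
    have h3 : Summable fun n => multHilbertMatrix m n * ‖g n‖ :=
      Complex.summable_ofReal.1 h2.summable
    have h4 := (Complex.hasSum_ofReal.2 h3.hasSum).unique h2
    rw [← h4, Complex.norm_real, Real.norm_of_nonneg
      (tsum_nonneg fun n => mul_nonneg (multHilbertMatrix_nonneg _ _) (norm_nonneg _))]
    exact h3.hasSum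
  rw [summable_prod_of_nonneg h0]
  have hrow : ∀ m, HasSum (fun n => ‖f m‖ * ‖g n‖ * multHilbertMatrix m n)
      (‖f m‖ * ‖multHilbertOperator g' m‖) := fun m => by
    have e : (fun n => ‖f m‖ * ‖g n‖ * multHilbertMatrix m n) =
        fun n => ‖f m‖ * (multHilbertMatrix m n * ‖g n‖) := by
      funext n
      ring
    rw [e]
    exact (hg m).mul_left ‖f m‖
  refine ⟨fun m => (hrow m).summable, ?_⟩
  simp_rw [fun m => (hrow m).tsum_eq]
  refine Summable.of_nonneg_of_le (fun m => by positivity) (fun m => ?_)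
    ((lp_two_summable_sq f).add (lp_two_summable_sq (multHilbertOperator g')))
  nlinarith [sq_nonneg (‖f m‖ - ‖multHilbertOperator g' m‖), sq_nonneg ‖f m‖,
    sq_nonneg ‖multHilbertOperator g' m‖]

/-- The multiplicative Hilbert matrix is the Gram matrix of the functions `n^{-w}` in
`L²(1/2, ∞)`. -/
theorem integral_eval_mul_eval (f g : DirichletH20) :
    IntegrableOn (fun w : ℝ => DirichletH20.eval f w * DirichletH20.eval g w) (Ioi (1 / 2)) ∧
    HasSum (fun m => f m * multHilbertOperator g m)
      (∫ w in Ioi (1 / 2 : ℝ), DirichletH20.eval f w * DirichletH20.eval g w) := by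
  set F : IndexTwo × IndexTwo → ℝ → ℂ := fun p w =>
    (f p.1 * ((p.1 : ℕ) : ℂ) ^ (-(w : ℂ))) * (g p.2 * ((p.2 : ℕ) : ℂ) ^ (-(w : ℂ))) with hF
  have e : ∀ p w, F p w = (f p.1 * g p.2) * ((Real.exp (-(Real.log (p.1 : ℕ) * w)) *
      Real.exp (-(Real.log (p.2 : ℕ) * w)) : ℝ) : ℂ) := fun p w => by
    simp only [hF, natCast_cpow_neg_ofReal]
    push_cast
    ring
  have hn : ∀ p w, ‖F p w‖ = ‖f p.1‖ * ‖g p.2‖ * (Real.exp (-(Real.log (p.1 : ℕ) * w)) *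
      Real.exp (-(Real.log (p.2 : ℕ) * w))) := fun p w => by
    rw [e, norm_mul, norm_mul, Complex.norm_real, Real.norm_of_nonneg (by positivity)]
  have hI : ∀ p, IntegrableOn (F p) (Ioi (1 / 2)) := fun p => by
    have := ((exp_mul_exp_integral p.1 p.2).1.ofReal (𝕜 := ℂ)).const_mul (f p.1 * g p.2)
    exact this.congr (Filter.Eventually.of_forall fun w => (e p w).symm)
  -- The `L¹` norm of a term is the matrix entry times the moduli of the coefficients, so absolute
  -- convergence of the bilinear form permits termwise integration.
  have hs : Summable fun p => ∫ w in Ioi (1 / 2 : ℝ), ‖F p w‖ := by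
    refine (summable_multHilbertMatrix_mul_norm f g).congr fun p => ?_
    simp_rw [hn]
    rw [integral_const_mul, (exp_mul_exp_integral p.1 p.2).2]
  have hprod : EqOn (fun w : ℝ => ∑' p, F p w)
      (fun w : ℝ => DirichletH20.eval f w * DirichletH20.eval g w) (Ioi (1 / 2)) := fun w hw => by
    have hw' : 1 / 2 < (w : ℂ).re := by simpa using hw
    exact (tsum_mul_tsum_of_summable_norm (f.summable_eval hw').norm
      (g.summable_eval hw').norm).symm
  have hval : ∀ p, ∫ w in Ioi (1 / 2 : ℝ), F p w =
      f p.1 * ((multHilbertMatrix p.1 p.2 : ℂ) * g p.2) := fun p => by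
    simp_rw [e]
    rw [integral_const_mul, integral_complex_ofReal, (exp_mul_exp_integral p.1 p.2).2]
    ring
  refine ⟨(integrable_tsum_of_summable_integral_norm hI hs).congr
    ((ae_restrict_iff' measurableSet_Ioi).2 (Filter.Eventually.of_forall hprod)), ?_⟩
  have h1 := hasSum_integral_of_summable_integral_norm hI hs
  rw [setIntegral_congr_fun measurableSet_Ioi hprod] at h1
  simp_rw [hval] at h1
  exact h1.prod_fiberwise fun m => (hasSum_multHilbertOperator g m).mul_left (f m)

theorem hasSum_natCast_cpow_zeta {s : ℂ} (hs : 1 < s.re) :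
    HasSum (fun n : IndexTwo => ((n : ℕ) : ℂ) ^ (-s)) (riemannZeta s - 1) := by
  have h0 : Summable fun n : ℕ => 1 / ((n : ℂ) + 1) ^ s := by
    have := (summable_nat_add_iff 1).2 (Complex.summable_one_div_nat_cpow.2 hs)
    simpa using this
  have h1 : HasSum (fun n : ℕ => 1 / ((n : ℂ) + 1) ^ s) (riemannZeta s) := by
    rw [zeta_eq_tsum_one_div_nat_add_one_cpow hs]
    exact h0.hasSum
  -- The term removed is that of `n = 1`, whose value is `1`.
  have h2 := (hasSum_nat_add_iff' 1).2 h1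
  simp only [Finset.range_one, Finset.sum_singleton, Nat.cast_zero, zero_add, Complex.one_cpow,
    div_one] at h2
  rw [← IndexTwo.natEquiv.hasSum_iff]
  have e : (fun n : IndexTwo => ((n : ℕ) : ℂ) ^ (-s)) ∘ IndexTwo.natEquiv =
      fun k : ℕ => 1 / (((k + 1 : ℕ) : ℂ) + 1) ^ s := by
    funext k
    simp only [IndexTwo.natEquiv, Equiv.coe_fn_mk, Function.comp]
    rw [Complex.cpow_neg, one_div]
    push_cast
    ring_nf
  rw [e]
  exact h2

/-- The integral representation of the operator. -/
theorem integrableOn_zetaIntegrand_and_eval_eq (f : DirichletH20) {s : ℂ} (hs : 1 / 2 < s.re) :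
    IntegrableOn (zetaIntegrand f s) (Ioi (1 / 2 : ℝ)) ∧
      DirichletH20.eval (multHilbertOperator f) s =
        ∫ w in Ioi (1 / 2 : ℝ), zetaIntegrand f s w := by
  -- `ζ(w+s) - 1` is the Dirichlet series in `w` with coefficients `n^{-s}`, and these are
  -- square-summable because `Re s > 1/2`.
  let u : DirichletH20 := ⟨fun n => ((n : ℕ) : ℂ) ^ (-s), memℓp_two_of_summable_sq (by
    have h2 : Summable fun n : IndexTwo => ((n : ℕ) : ℝ) ^ (-(2 * s.re)) :=
      (Real.summable_nat_rpow.2 (by linarith)).comp_injective Subtype.val_injective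
    refine h2.congr fun n => ?_
    rw [Complex.norm_natCast_cpow_of_pos (by exact_mod_cast n.pos), Complex.neg_re,
      ← Real.rpow_natCast, ← Real.rpow_mul n.pos.le]
    congr 1
    push_cast
    ring)⟩
  have hu : ∀ n, u n = ((n : ℕ) : ℂ) ^ (-s) := fun n => rfl
  have hev : EqOn (fun w : ℝ => DirichletH20.eval u w * DirichletH20.eval f w)
      (zetaIntegrand f s) (Ioi (1 / 2)) := fun w hw => by
    have hw' : 1 < ((w : ℂ) + s).re := by
      rw [Complex.add_re, Complex.ofReal_re]
      linarith [mem_Ioi.1 hw]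
    simp only [zetaIntegrand]
    rw [mul_comm, ← (hasSum_natCast_cpow_zeta hw').tsum_eq]
    congr 1
    refine tsum_congr fun n => ?_
    have hn : ((n : ℕ) : ℂ) ≠ 0 := by exact_mod_cast n.pos.ne'
    rw [hu, ← Complex.cpow_add _ _ hn]
    congr 1
    ring
  obtain ⟨h1, h2⟩ := integral_eval_mul_eval u f
  refine ⟨h1.congr_fun hev measurableSet_Ioi, ?_⟩
  rw [← setIntegral_congr_fun measurableSet_Ioi hev, ← h2.tsum_eq]
  exact tsum_congr fun m => by rw [hu, mul_comm]

/-- The quadratic form of the operator. -/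
theorem inner_multHilbertOperator (f : DirichletH20) :
    IntegrableOn (fun w : ℝ => ‖DirichletH20.eval f w‖ ^ 2) (Ioi (1 / 2)) ∧
    ⟪multHilbertOperator f, f⟫_ℂ =
      ((∫ w in Ioi (1 / 2 : ℝ), ‖DirichletH20.eval f w‖ ^ 2 : ℝ) : ℂ) := by
  -- For real `w`, conjugating the coefficients conjugates the value, so `|f(w)|²` is a product of
  -- two Dirichlet series from the space.
  let g : DirichletH20 := ⟨fun n => (starRingEnd ℂ) (f n), memℓp_two_of_summable_sq (by
    simpa using lp_two_summable_sq f)⟩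
  have hg : ∀ n, g n = (starRingEnd ℂ) (f n) := fun n => rfl
  have hev : ∀ w : ℝ, DirichletH20.eval g w = (starRingEnd ℂ) (DirichletH20.eval f w) := fun w => by
    simp only [DirichletH20.eval]
    rw [Complex.conj_tsum]
    refine tsum_congr fun n => ?_
    rw [hg, map_mul, natCast_cpow_neg_ofReal, Complex.conj_ofReal]
  have hH : ∀ m, multHilbertOperator g m = (starRingEnd ℂ) (multHilbertOperator f m) := fun m => by
    refine (hasSum_multHilbertOperator g m).unique ?_
    convert Complex.hasSum_conj'.2 (hasSum_multHilbertOperator f m) using 2 with n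
    · rw [hg, map_mul, Complex.conj_ofReal]
  have hpt : ∀ w : ℝ, DirichletH20.eval f w * DirichletH20.eval g w =
      ((‖DirichletH20.eval f w‖ ^ 2 : ℝ) : ℂ) := fun w => by
    rw [hev, Complex.mul_conj, Complex.normSq_eq_norm_sq]
  obtain ⟨h1, h2⟩ := integral_eval_mul_eval f g
  simp_rw [hpt] at h1 h2
  refine ⟨h1.re.congr (Filter.Eventually.of_forall fun w => Complex.ofReal_re _), ?_⟩
  rw [← integral_complex_ofReal, ← h2.tsum_eq, lp.inner_eq_tsum]
  refine tsum_congr fun m => ?_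
  rw [hH, RCLike.inner_apply]

theorem DirichletH20.continuousOn_eval (f : DirichletH20) :
    ContinuousOn (fun w : ℝ => DirichletH20.eval f w) (Ioi 1) := by
  have h1 : Summable fun n : IndexTwo => ‖f n * ((n : ℕ) : ℂ) ^ (-(1 : ℂ))‖ :=
    (f.summable_eval (by norm_num)).norm
  refine continuousOn_tsum (fun n => ?_) h1 fun n w hw => ?_
  · refine Continuous.continuousOn ?_
    simp_rw [natCast_cpow_neg_ofReal]
    fun_prop
  · rw [norm_mul, norm_mul]
    have hn : 0 < (n : ℕ) := by exact_mod_cast n.pos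
    rw [Complex.norm_natCast_cpow_of_pos hn, Complex.norm_natCast_cpow_of_pos hn]
    refine mul_le_mul_of_nonneg_left ?_ (norm_nonneg _)
    refine Real.rpow_le_rpow_of_exponent_le (by linarith [n.two_le]) ?_
    simpa using (mem_Ioi.1 hw).le

/-- A Dirichlet series in the space that vanishes on a half-line is zero. -/
theorem DirichletH20.eq_zero_of_eval (f : DirichletH20)
    (h : ∀ w : ℝ, 1 < w → DirichletH20.eval f w = 0) : f = 0 := by
  let c : ℕ → ℂ := fun n => if h : 2 ≤ n then f ⟨n, h⟩ else 0
  have term_eq : ∀ (s : ℂ) (n : IndexTwo),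
      LSeries.term c s n = f n * ((n : ℕ) : ℂ) ^ (-s) := fun s n => by
    have hn : (n : ℕ) ≠ 0 := (lt_of_lt_of_le two_pos n.2).ne'
    rw [LSeries.term_of_ne_zero hn, Complex.cpow_neg, div_eq_mul_inv]
    simp [c, n.2]
  have supp : ∀ s : ℂ, Function.support (LSeries.term c s) ⊆ {n : ℕ | 2 ≤ n} := by
    intro s n hn
    by_contra h'
    refine hn ?_
    have h' : ¬ 2 ≤ n := h'
    rcases eq_or_ne n 0 with rfl | h0
    · simp
    · rw [LSeries.term_of_ne_zero h0]
      simp [c, h']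
  have L : ∀ s : ℂ, LSeries c s = DirichletH20.eval f s := fun s => by
    rw [LSeries, ← tsum_subtype_eq_of_support_subset (supp s)]
    exact tsum_congr fun n => term_eq s n
  have S : LSeries.abscissaOfAbsConv c < ⊤ := by
    have hs : LSeriesSummable c 1 := by
      have := f.summable_eval (s := 1) (by norm_num)
      rw [LSeriesSummable, ← Set.indicator_eq_self.2 (supp 1), ← summable_subtype_iff_indicator]
      exact this.congr fun n => (term_eq 1 n).symm
    exact lt_of_le_of_lt hs.abscissaOfAbsConv_le (EReal.coe_lt_top _)
  have S0 : LSeries.abscissaOfAbsConv (0 : ℕ → ℂ) < ⊤ := by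
    exact lt_of_le_of_lt (LSeriesSummable_zero (s := 1)).abscissaOfAbsConv_le
      (EReal.coe_lt_top _)
  ext n
  have hn : (n : ℕ) ≠ 0 := (lt_of_lt_of_le two_pos n.2).ne'
  have key := LSeries.eq_of_LSeries_eventually_eq S S0
    (by
      filter_upwards [Filter.eventually_gt_atTop (1 : ℝ)] with x hx
      rw [L, h x hx]
      simp) hn
  simpa [c, n.2] using key

/-- The operator is strictly positive. -/
theorem inner_multHilbertOperator_pos {f : DirichletH20} (hf : f ≠ 0) :
    0 < (⟪multHilbertOperator f, f⟫_ℂ).re := by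
  obtain ⟨h1, h2⟩ := inner_multHilbertOperator f
  rw [h2, Complex.ofReal_re]
  refine lt_of_le_of_ne (integral_nonneg fun w => by positivity) fun h0 => hf ?_
  refine f.eq_zero_of_eval fun w hw => ?_
  have h3 := (setIntegral_eq_zero_iff_of_nonneg_ae
    (Filter.Eventually.of_forall fun w => by positivity) h1).1 h0.symm
  -- On `(1, ∞)` the series is continuous, so vanishing almost everywhere becomes vanishing
  -- everywhere, which already determines the coefficients.
  have h4 := ae_restrict_of_ae_restrict_of_subset
    (Ioi_subset_Ioi (by norm_num : (1 / 2 : ℝ) ≤ 1)) h3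
  have h5 := Measure.eqOn_open_of_ae_eq h4 isOpen_Ioi (f.continuousOn_eval.norm.pow 2)
    continuousOn_const hw
  simpa using h5

theorem isPositive_multHilbertOperator : multHilbertOperator.IsPositive := by
  rw [ContinuousLinearMap.isPositive_iff_complex]
  intro f
  rw [(inner_multHilbertOperator f).2]
  exact ⟨by simp, by simpa using integral_nonneg fun w => by positivity⟩

/-! ### Euler summation in the logarithmic scale and Mellin transforms -/

/-- A differentiable function on `(0, ∞)` bounded by `A`, with continuous derivative bounded by `A`
on `[log 2, ∞)`. -/
structure TameAmplitude (φ φ' : ℝ → ℂ) (A : ℝ) : Prop where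
  hasDerivAt : ∀ x, 0 < x → HasDerivAt φ (φ' x) x
  continuousOn_deriv : ContinuousOn φ' (Ioi 0)
  norm_le : ∀ x, 0 < x → ‖φ x‖ ≤ A
  norm_deriv_le : ∀ x, Real.log 2 ≤ x → ‖φ' x‖ ≤ A

/-- The distance from `e^x` to the next larger integer. -/
noncomputable def ceilGap (x : ℝ) : ℝ := ⌊Real.exp x⌋₊ + 1 - Real.exp x

theorem ceilGap_mem (x : ℝ) : 0 ≤ ceilGap x ∧ ceilGap x ≤ 1 := by
  have h1 := Nat.floor_le (Real.exp_pos x).le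
  have h2 := Nat.lt_floor_add_one (Real.exp x)
  constructor <;> simp only [ceilGap] <;> linarith

theorem measurable_ceilGap : Measurable ceilGap := by
  unfold ceilGap
  have h : Measurable fun x : ℝ => (⌊Real.exp x⌋₊ : ℝ) :=
    (measurable_from_nat (f := fun n : ℕ => (n : ℝ))).comp
      (Nat.measurable_floor.comp Real.measurable_exp)
  exact (h.add_const 1).sub Real.measurable_exp

/-- The function whose Mellin transform carries the first-order part of the discrepancy between
`∑ φ(log n) (log n)^{w-1} / n` and the Mellin transform of `φ`. -/
noncomputable def gapDeriv (φ φ' : ℝ → ℂ) : ℝ → ℂ :=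
  (Ioi (Real.log 2)).indicator fun x => ((ceilGap x * Real.exp (-x) : ℝ) : ℂ) * (φ' x - φ x)

/-- The function whose Mellin transform carries the part of the discrepancy that comes from the
derivative of the power. -/
noncomputable def gapValue (φ : ℝ → ℂ) : ℝ → ℂ :=
  (Ioi (Real.log 2)).indicator fun x => ((ceilGap x * Real.exp (-x) : ℝ) : ℂ) * φ x

/-- The discrepancy between `∑ φ(log n) (log n)^{w-1} / n` and the Mellin transform of `φ`. -/
noncomputable def mellinDiscrepancy (φ φ' : ℝ → ℂ) (w : ℂ) : ℂ :=
  -mellin (gapDeriv φ φ') w - (w - 1) * mellin (gapValue φ) (w - 1)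
    - mellin ((Iic (Real.log 2)).indicator φ) w

/-- Exponential decay settles convergence at infinity for every exponent, so only the behaviour at
`0` restricts `w`. -/
theorem mellin_of_norm_le_exp {h : ℝ → ℂ} {B b : ℝ} {w : ℂ}
    (hm : AEStronglyMeasurable h (volume.restrict (Ioi 0)))
    (hB : ∀ x, 0 < x → ‖h x‖ ≤ B * Real.exp (-x))
    (h0 : h =O[nhdsWithin 0 (Ioi 0)] fun x => x ^ (-b)) (hb : b < w.re) :
    MellinConvergent h w ∧ DifferentiableAt ℂ (mellin h) w := by
  have hi : IntegrableOn h (Ioi 0) := by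
    have h1 : IntegrableOn (fun x : ℝ => B * Real.exp (-x)) (Ioi 0) := by
      have := (exp_neg_integrableOn_Ioi 0 one_pos).const_mul B
      simpa [IntegrableOn] using this
    refine h1.mono' hm ?_
    exact (ae_restrict_iff' measurableSet_Ioi).2 (Filter.Eventually.of_forall hB)
  have ht : h =O[Filter.atTop] fun x => Real.exp (-1 * x) := by
    refine Asymptotics.IsBigO.of_bound B ?_
    filter_upwards [Filter.eventually_gt_atTop 0] with x hx
    rw [neg_one_mul, Real.norm_of_nonneg (Real.exp_pos _).le]
    exact hB x hx
  exact ⟨mellinConvergent_of_isBigO_rpow_exp one_pos hi.locallyIntegrableOn ht h0 hb,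
    mellin_differentiableAt_of_isBigO_rpow_exp one_pos hi.locallyIntegrableOn ht h0 hb⟩

theorem indicator_Ioi_isBigO_rpow {h : ℝ → ℂ} (b : ℝ) :
    (Ioi (Real.log 2)).indicator h =O[nhdsWithin 0 (Ioi 0)] fun x => x ^ (-b) := by
  refine Asymptotics.IsBigO.of_bound 0 ?_
  have : Iio (Real.log 2) ∈ nhds (0 : ℝ) := Iio_mem_nhds (Real.log_pos one_lt_two)
  filter_upwards [mem_nhdsWithin_of_mem_nhds this] with x hx
  rw [indicator_of_notMem (by simpa using (mem_Iio.1 hx).le)]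
  simp

theorem mellin_indicator {S : Set ℝ} (hS : MeasurableSet S) (f : ℝ → ℂ) (w : ℂ) :
    mellin (S.indicator f) w = ∫ x in Ioi 0 ∩ S, (x : ℂ) ^ (w - 1) * f x := by
  rw [mellin, ← setIntegral_indicator hS]
  congr 1
  funext x
  by_cases hx : x ∈ S <;> simp [hx]

/-- On `x ≥ log 2 > 1/2` negative powers cost at most a factor `2`, and positive ones are paid for
with half of the decay `e^{-x}`. -/
theorem rpow_le_two_mul_exp {x a : ℝ} (hx : Real.log 2 ≤ x) (ha : -1 ≤ a) (ha1 : a ≤ 1) :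
    x ^ a ≤ 2 * Real.exp (x / 2) := by
  have hl : (1 / 2 : ℝ) ≤ x := by linarith [Real.log_two_gt_d9]
  have h1 := Real.add_one_le_exp (x / 2)
  rcases le_total 1 x with h | h
  · calc x ^ a ≤ x ^ (1 : ℝ) := Real.rpow_le_rpow_of_exponent_le h ha1
      _ = x := Real.rpow_one x
      _ ≤ _ := by linarith
  · calc x ^ a ≤ x ^ (-1 : ℝ) := Real.rpow_le_rpow_of_exponent_ge (by linarith) h ha
      _ = 1 / x := by rw [Real.rpow_neg_one, one_div]
      _ ≤ 2 := by rw [div_le_iff₀ (by linarith)]; linarith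
      _ ≤ _ := by linarith

namespace TameAmplitude

variable {φ φ' : ℝ → ℂ} {A : ℝ}

theorem nonneg (h : TameAmplitude φ φ' A) : 0 ≤ A :=
  (norm_nonneg _).trans (h.norm_le 1 one_pos)

theorem continuousOn (h : TameAmplitude φ φ' A) : ContinuousOn φ (Ioi 0) := fun x hx =>
  (h.hasDerivAt x hx).continuousAt.continuousWithinAt

theorem aestronglyMeasurable_gap {g : ℝ → ℂ} (hg : ContinuousOn g (Ioi 0)) :
    AEStronglyMeasurable ((Ioi (Real.log 2)).indicator fun x =>
      ((ceilGap x * Real.exp (-x) : ℝ) : ℂ) * g x) (volume.restrict (Ioi 0)) := by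
  refine AEStronglyMeasurable.indicator ?_ measurableSet_Ioi
  refine AEStronglyMeasurable.mul ?_ (hg.aestronglyMeasurable measurableSet_Ioi)
  exact (Complex.measurable_ofReal.comp (measurable_ceilGap.mul
    (Real.measurable_exp.comp measurable_neg))).aestronglyMeasurable

theorem norm_gap_le {g : ℝ → ℂ} {B : ℝ} (hB0 : 0 ≤ B) (hB : ∀ x, Real.log 2 ≤ x → ‖g x‖ ≤ B)
    (x : ℝ) : ‖(Ioi (Real.log 2)).indicator (fun x =>
      ((ceilGap x * Real.exp (-x) : ℝ) : ℂ) * g x) x‖ ≤ B * Real.exp (-x) := by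
  by_cases hx : x ∈ Ioi (Real.log 2)
  · rw [indicator_of_mem hx, norm_mul, Complex.norm_real,
      Real.norm_of_nonneg (mul_nonneg (ceilGap_mem x).1 (Real.exp_pos _).le)]
    calc ceilGap x * Real.exp (-x) * ‖g x‖ ≤ 1 * Real.exp (-x) * B := by
          have := (ceilGap_mem x).2
          have := hB x (mem_Ioi.1 hx).le
          have := (ceilGap_mem x).1
          gcongr
      _ = _ := by ring
  · rw [indicator_of_notMem hx, norm_zero]
    positivity

theorem norm_deriv_sub_le (h : TameAmplitude φ φ' A) (x : ℝ) (hx : Real.log 2 ≤ x) :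
    ‖φ' x - φ x‖ ≤ 2 * A := by
  have := norm_sub_le (φ' x) (φ x)
  have := h.norm_le x (lt_of_lt_of_le (Real.log_pos one_lt_two) hx)
  have := h.norm_deriv_le x hx
  linarith

/-- The support stays away from `0`, so the exponent `b` is free and the Mellin transform is entire.
The same holds for `gapValue`. -/
theorem mellin_gapDeriv (h : TameAmplitude φ φ' A) (w : ℂ) :
    MellinConvergent (gapDeriv φ φ') w ∧ DifferentiableAt ℂ (mellin (gapDeriv φ φ')) w :=
  mellin_of_norm_le_exp (b := w.re - 1)
    (aestronglyMeasurable_gap (h.continuousOn_deriv.sub h.continuousOn))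
    (fun x _ => norm_gap_le (by linarith [h.nonneg]) h.norm_deriv_sub_le x)
    (indicator_Ioi_isBigO_rpow _) (by linarith)

theorem mellin_gapValue (h : TameAmplitude φ φ' A) (w : ℂ) :
    MellinConvergent (gapValue φ) w ∧ DifferentiableAt ℂ (mellin (gapValue φ)) w :=
  mellin_of_norm_le_exp (b := w.re - 1) (aestronglyMeasurable_gap h.continuousOn)
    (fun x _ => norm_gap_le h.nonneg
      (fun x hx => h.norm_le x (lt_of_lt_of_le (Real.log_pos one_lt_two) hx)) x)
    (indicator_Ioi_isBigO_rpow _) (by linarith)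

theorem mellin_head (h : TameAmplitude φ φ' A) {w : ℂ} (hw : 0 < w.re) :
    MellinConvergent ((Iic (Real.log 2)).indicator φ) w ∧
      DifferentiableAt ℂ (mellin ((Iic (Real.log 2)).indicator φ)) w := by
  have hA := h.nonneg
  have hle : ∀ x, 0 < x → ‖(Iic (Real.log 2)).indicator φ x‖ ≤ A := fun x hx => by
    by_cases hx' : x ∈ Iic (Real.log 2)
    · rw [indicator_of_mem hx']
      exact h.norm_le x hx
    · rw [indicator_of_notMem hx', norm_zero]
      exact hA
  -- The factor `2` comes from `e^{-x} ≥ 1/2` on `(0, log 2]`. Near `0` only boundedness is known,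
  -- whence `b = 0` and the restriction `Re w > 0`.
  refine mellin_of_norm_le_exp (b := 0) (B := 2 * A)
    ((h.continuousOn.aestronglyMeasurable measurableSet_Ioi).indicator measurableSet_Iic)
    (fun x hx => ?_) ?_ hw
  · by_cases hx' : x ∈ Iic (Real.log 2)
    · have h1 : Real.exp (-Real.log 2) ≤ Real.exp (-x) :=
        Real.exp_le_exp.2 (neg_le_neg (mem_Iic.1 hx'))
      rw [Real.exp_neg, Real.exp_log two_pos] at h1
      nlinarith [hle x hx]
    · rw [indicator_of_notMem hx', norm_zero]
      positivity
  · refine Asymptotics.IsBigO.of_bound A ?_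
    filter_upwards [self_mem_nhdsWithin] with x hx
    simpa using hle x hx

theorem differentiableAt_mellinDiscrepancy (h : TameAmplitude φ φ' A) {w : ℂ} (hw : 0 < w.re) :
    DifferentiableAt ℂ (mellinDiscrepancy φ φ') w := by
  have h2 : DifferentiableAt ℂ (fun w : ℂ => mellin (gapValue φ) (w - 1)) w :=
    DifferentiableAt.comp (g := mellin (gapValue φ)) (f := fun w : ℂ => w - 1) w
      (h.mellin_gapValue (w - 1)).2 (differentiableAt_id.sub_const 1)
  exact ((h.mellin_gapDeriv w).2.neg.sub ((differentiableAt_id.sub_const 1).mul h2)).sub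
    (h.mellin_head hw).2

theorem norm_mellin_gap_le {g : ℝ → ℂ} {B a : ℝ} {w : ℂ} (hB0 : 0 ≤ B) (ha : 0 ≤ a)
    (hg : ∀ x, ‖(Ioi (Real.log 2)).indicator g x‖ ≤ B * Real.exp (-x))
    (hw : ∀ x, Real.log 2 ≤ x → x ^ (w.re - 1) ≤ a * Real.exp (x / 2)) :
    ‖mellin ((Ioi (Real.log 2)).indicator g) w‖ ≤ 2 * a * B := by
  have hi : IntegrableOn (fun x : ℝ => a * B * Real.exp (-(1 / 2) * x)) (Ioi 0) :=
    (integrableOn_exp_mul_Ioi (by norm_num) 0).const_mul _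
  have hv : ∫ x in Ioi (0 : ℝ), a * B * Real.exp (-(1 / 2) * x) = 2 * a * B := by
    rw [integral_const_mul, integral_exp_mul_Ioi (by norm_num)]
    norm_num
    ring
  rw [mellin, ← hv]
  refine norm_integral_le_of_norm_le hi ?_
  refine (ae_restrict_iff' measurableSet_Ioi).2 (Filter.Eventually.of_forall fun x hx => ?_)
  by_cases hx' : x ∈ Ioi (Real.log 2)
  · rw [norm_smul, Complex.norm_cpow_eq_rpow_re_of_pos hx, Complex.sub_re, Complex.one_re]
    calc x ^ (w.re - 1) * ‖(Ioi (Real.log 2)).indicator g x‖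
        ≤ a * Real.exp (x / 2) * (B * Real.exp (-x)) :=
          mul_le_mul (hw x (mem_Ioi.1 hx').le) (hg x) (norm_nonneg _) (by positivity)
      _ = a * B * (Real.exp (x / 2) * Real.exp (-x)) := by ring
      _ = _ := by
          rw [← Real.exp_add]
          ring_nf
  · rw [indicator_of_notMem hx', smul_zero, norm_zero]
    positivity

/-- The growth in `w` is only linear and comes from the factor `w - 1` produced by differentiating
the power. The three pieces contribute `8A`, `8A (‖w‖ + 1)` and `4A`. -/
theorem norm_mellinDiscrepancy_le (h : TameAmplitude φ φ' A) {w : ℂ} (hw : 1 / 4 ≤ w.re)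
    (hw2 : w.re ≤ 2) : ‖mellinDiscrepancy φ φ' w‖ ≤ 20 * A * (1 + ‖w‖) := by
  have hA := h.nonneg
  have h1 : ‖mellin (gapDeriv φ φ') w‖ ≤ 2 * 2 * (2 * A) :=
    norm_mellin_gap_le (by linarith) two_pos.le
      (fun x => norm_gap_le (by linarith) h.norm_deriv_sub_le x)
      fun x hx => rpow_le_two_mul_exp hx (by linarith) (by linarith)
  have h2 : ‖mellin (gapValue φ) (w - 1)‖ ≤ 2 * 4 * A :=
    norm_mellin_gap_le hA (by norm_num) (fun x => norm_gap_le hA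
      (fun x hx => h.norm_le x (lt_of_lt_of_le (Real.log_pos one_lt_two) hx)) x)
      fun x hx => by
        have hx0 : (1 / 2 : ℝ) ≤ x := by linarith [Real.log_two_gt_d9]
        rw [Complex.sub_re, Complex.one_re, Real.rpow_sub_one (by linarith),
          div_le_iff₀ (by linarith)]
        have := rpow_le_two_mul_exp hx (a := w.re - 1) (by linarith) (by linarith)
        nlinarith [Real.exp_pos (x / 2)]
  have h3 : ‖mellin ((Iic (Real.log 2)).indicator φ) w‖ ≤ 4 * A := by
    have hl1 : Real.log 2 ≤ 1 := by linarith [Real.log_two_lt_d9]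
    have hr : -1 < w.re - 1 := by linarith
    have hi : IntegrableOn (fun x : ℝ => A * x ^ (w.re - 1)) (Ioc 0 1) := by
      refine Integrable.const_mul ?_ A
      exact (intervalIntegrable_iff_integrableOn_Ioc_of_le zero_le_one).1
        (intervalIntegral.intervalIntegrable_rpow' hr)
    have hv : ∫ x in Ioc (0 : ℝ) 1, A * x ^ (w.re - 1) ≤ 4 * A := by
      rw [integral_const_mul, ← intervalIntegral.integral_of_le zero_le_one,
        integral_rpow (Or.inl hr)]
      rw [sub_add_cancel, Real.one_rpow, Real.zero_rpow (by linarith), sub_zero, mul_comm]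
      refine mul_le_mul_of_nonneg_right ?_ hA
      rw [div_le_iff₀ (by linarith)]
      linarith
    rw [mellin_indicator measurableSet_Iic, Ioi_inter_Iic]
    have hsub : Ioc 0 (Real.log 2) ⊆ Ioc (0 : ℝ) 1 := Ioc_subset_Ioc_right hl1
    calc ‖∫ x in Ioc 0 (Real.log 2), (x : ℂ) ^ (w - 1) * φ x‖
        ≤ ∫ x in Ioc 0 (Real.log 2), A * x ^ (w.re - 1) := by
          refine norm_integral_le_of_norm_le (hi.mono_set hsub) ?_
          refine (ae_restrict_iff' measurableSet_Ioc).2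
            (Filter.Eventually.of_forall fun x hx => ?_)
          rw [norm_mul, Complex.norm_cpow_eq_rpow_re_of_pos hx.1, Complex.sub_re, Complex.one_re,
            mul_comm]
          exact mul_le_mul_of_nonneg_right (h.norm_le x hx.1) (Real.rpow_nonneg hx.1.le _)
      _ ≤ ∫ x in Ioc (0 : ℝ) 1, A * x ^ (w.re - 1) := by
          refine setIntegral_mono_set hi ?_ hsub.eventuallyLE
          refine (ae_restrict_iff' measurableSet_Ioc).2
            (Filter.Eventually.of_forall fun x hx => ?_)
          exact mul_nonneg hA (Real.rpow_nonneg hx.1.le _)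
      _ ≤ 4 * A := hv
  have h4 : ‖w - 1‖ ≤ ‖w‖ + 1 := by simpa using norm_sub_le w 1
  have h5 : ‖(w - 1) * mellin (gapValue φ) (w - 1)‖ ≤ (‖w‖ + 1) * (2 * 4 * A) := by
    rw [norm_mul]
    exact mul_le_mul h4 h2 (norm_nonneg _) (by positivity)
  calc ‖mellinDiscrepancy φ φ' w‖
      ≤ ‖mellin (gapDeriv φ φ') w‖ + ‖(w - 1) * mellin (gapValue φ) (w - 1)‖ +
        ‖mellin ((Iic (Real.log 2)).indicator φ) w‖ := by
        simp only [mellinDiscrepancy]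
        refine (norm_sub_le _ _).trans (add_le_add_left ((norm_sub_le _ _).trans ?_) _)
        rw [norm_neg]
    _ ≤ 20 * A * (1 + ‖w‖) := by nlinarith [norm_nonneg w, mul_nonneg hA (norm_nonneg w)]

end TameAmplitude

theorem iUnion_Ico_log : ⋃ n : IndexTwo, Ico (Real.log (n : ℕ)) (Real.log ((n : ℕ) + 1)) =
    Ici (Real.log 2) := by
  ext x
  simp only [mem_iUnion, mem_Ico, mem_Ici]
  constructor
  · rintro ⟨n, hn, -⟩
    exact n.log_two_le.trans hn
  · intro hx
    have h2 : (2 : ℝ) ≤ Real.exp x := by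
      rw [← Real.log_le_iff_le_exp two_pos]
      exact hx
    refine ⟨⟨⌊Real.exp x⌋₊, Nat.le_floor (by exact_mod_cast h2)⟩, ?_, ?_⟩
    · have h3 : (0 : ℝ) < (⌊Real.exp x⌋₊ : ℝ) := by
        exact_mod_cast Nat.floor_pos.2 (by linarith)
      rw [Real.log_le_iff_le_exp h3]
      exact Nat.floor_le (Real.exp_pos x).le
    · rw [Real.lt_log_iff_exp_lt (by positivity)]
      exact Nat.lt_floor_add_one _

theorem floor_exp_of_mem_Ico_log {n : IndexTwo} {x : ℝ}
    (hx : x ∈ Ico (Real.log (n : ℕ)) (Real.log ((n : ℕ) + 1))) : ⌊Real.exp x⌋₊ = (n : ℕ) := by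
  rw [Nat.floor_eq_iff (Real.exp_pos x).le]
  refine ⟨(Real.log_le_iff_le_exp n.pos).1 hx.1, (Real.lt_log_iff_exp_lt ?_).1 hx.2⟩
  linarith [n.pos]

theorem pairwise_disjoint_Ico_log : Pairwise (Function.onFun Disjoint
    fun n : IndexTwo => Ico (Real.log (n : ℕ)) (Real.log ((n : ℕ) + 1))) := by
  intro m n hmn
  rw [Function.onFun, disjoint_left]
  intro x hm hn
  exact hmn (Subtype.ext ((floor_exp_of_mem_Ico_log hm).symm.trans (floor_exp_of_mem_Ico_log hn)))

/-- One step of Euler summation in the logarithmic scale. -/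
theorem setIntegral_Ico_log_eq {θ θ' : ℝ → ℂ} (n : IndexTwo)
    (hθ : ∀ x, 0 < x → HasDerivAt θ (θ' x) x) (hc : ContinuousOn θ' (Ioi 0)) :
    ∫ x in Ico (Real.log (n : ℕ)) (Real.log ((n : ℕ) + 1)), θ x =
      θ (Real.log (n : ℕ)) / ((n : ℕ) : ℂ) +
      ∫ x in Ico (Real.log (n : ℕ)) (Real.log ((n : ℕ) + 1)),
        ((ceilGap x * Real.exp (-x) : ℝ) : ℂ) * (θ' x - θ x) := by
  set a := Real.log (n : ℕ) with ha
  set b := Real.log ((n : ℕ) + 1) with hb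
  have hab : a ≤ b := Real.log_le_log n.pos (by linarith)
  have ha0 : 0 < a := n.log_pos
  have hea : Real.exp a = (n : ℕ) := Real.exp_log n.pos
  have heb : Real.exp b = (n : ℕ) + 1 := Real.exp_log (by linarith [n.pos])
  have hsub : uIcc a b ⊆ Ioi 0 := by
    rw [uIcc_of_le hab]
    exact fun x hx => lt_of_lt_of_le ha0 hx.1
  -- This primitive of `e^x` vanishes at the right endpoint and equals `-1` at the left one, so
  -- integration by parts leaves the single boundary term `θ (log n) / n`. Inside the interval it is
  -- `-ceilGap`.
  set V : ℝ → ℂ := fun x => ((Real.exp x - ((n : ℕ) + 1) : ℝ) : ℂ) with hV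
  set W : ℝ → ℂ := fun x => ((Real.exp (-x) : ℝ) : ℂ) * θ x with hW
  set W' : ℝ → ℂ := fun x => ((Real.exp (-x) : ℝ) : ℂ) * (θ' x - θ x) with hW'
  have hVd : ∀ x, HasDerivAt V ((Real.exp x : ℝ) : ℂ) x := fun x =>
    ((Real.hasDerivAt_exp x).sub_const _).ofReal_comp
  have hWd : ∀ x ∈ uIcc a b, HasDerivAt W (W' x) x := fun x hx => by
    have h1 : HasDerivAt (fun x : ℝ => ((Real.exp (-x) : ℝ) : ℂ)) ((-Real.exp (-x) : ℝ) : ℂ) x := by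
      have := ((hasDerivAt_neg x).exp).ofReal_comp
      simpa using this
    refine (h1.mul (hθ x (hsub hx))).congr_deriv ?_
    simp only [hW']
    push_cast
    ring
  have hθc : ContinuousOn θ (Ioi 0) := fun x hx => (hθ x hx).continuousAt.continuousWithinAt
  have hW'c : ContinuousOn W' (uIcc a b) := by
    refine ContinuousOn.mul (Continuous.continuousOn ?_) ((hc.sub hθc).mono hsub)
    fun_prop
  have hibp := intervalIntegral.integral_mul_deriv_eq_deriv_mul (u := W) (v := V)
    (u' := W') (v' := fun x => ((Real.exp x : ℝ) : ℂ)) (a := a) (b := b) hWd (fun x _ => hVd x)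
    hW'c.intervalIntegrable (Continuous.intervalIntegrable (by fun_prop) _ _)
  have h1 : ∀ f : ℝ → ℂ, ∫ x in Ico a b, f x = ∫ x in a..b, f x := fun f => by
    rw [intervalIntegral.integral_of_le hab, integral_Ioc_eq_integral_Ioo,
      integral_Ico_eq_integral_Ioo]
  have h2 : ∫ x in a..b, W x * ((Real.exp x : ℝ) : ℂ) = ∫ x in a..b, θ x := by
    refine intervalIntegral.integral_congr fun x _ => ?_
    simp only [hW]
    rw [mul_right_comm, ← Complex.ofReal_mul, ← Real.exp_add, neg_add_cancel, Real.exp_zero,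
      Complex.ofReal_one, one_mul]
  have h3 : ∫ x in Ico a b, ((ceilGap x * Real.exp (-x) : ℝ) : ℂ) * (θ' x - θ x) =
      -∫ x in a..b, W' x * V x := by
    rw [← h1, ← integral_neg]
    refine setIntegral_congr_fun measurableSet_Ico fun x hx => ?_
    simp only [hW', hV, ceilGap, floor_exp_of_mem_Ico_log hx]
    push_cast
    ring
  rw [h3, h1, ← h2, hibp]
  have hVb : V b = 0 := by simp only [hV, heb, sub_self, Complex.ofReal_zero]
  have hVa : V a = -1 := by
    simp only [hV, hea]
    push_cast
    ring
  have hWa : W a = θ a / ((n : ℕ) : ℂ) := by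
    simp only [hW, Real.exp_neg, hea]
    push_cast
    rw [div_eq_mul_inv, mul_comm]
  rw [hVb, hVa, hWa]
  ring

theorem setIntegral_Ici_eq_mellin (g : ℝ → ℂ) (w : ℂ) :
    ∫ x in Ici (Real.log 2), (x : ℂ) ^ (w - 1) * g x =
      mellin ((Ioi (Real.log 2)).indicator g) w := by
  have : Ioi 0 ∩ Ioi (Real.log 2) = Ioi (Real.log 2) :=
    inter_eq_right.2 (Ioi_subset_Ioi (Real.log_pos one_lt_two).le)
  rw [mellin_indicator measurableSet_Ioi, this, integral_Ici_eq_integral_Ioi]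

theorem MellinConvergent.integrableOn_Ici_of_indicator {g : ℝ → ℂ} {w : ℂ}
    (h : MellinConvergent ((Ioi (Real.log 2)).indicator g) w) :
    IntegrableOn (fun x : ℝ => (x : ℂ) ^ (w - 1) * g x) (Ici (Real.log 2)) := by
  rw [integrableOn_Ici_iff_integrableOn_Ioi]
  refine (h.mono_set (Ioi_subset_Ioi (Real.log_pos one_lt_two).le)).congr_fun (fun x hx => ?_)
    measurableSet_Ioi
  simp only [indicator_of_mem hx, smul_eq_mul]

/-- Comparison of the sum `∑ φ(log n) (log n)^{w-1} / n` with the Mellin transform of `φ`. -/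
theorem TameAmplitude.hasSum_mellin {φ φ' : ℝ → ℂ} {A : ℝ} (h : TameAmplitude φ φ' A) {w : ℂ}
    (hc : MellinConvergent φ w) :
    HasSum (fun n : IndexTwo => ((Real.log (n : ℕ) : ℝ) : ℂ) ^ (w - 1) * φ (Real.log (n : ℕ)) /
      ((n : ℕ) : ℂ)) (mellin φ w + mellinDiscrepancy φ φ' w) := by
  have hl2 : 0 < Real.log 2 := Real.log_pos one_lt_two
  set θ : ℝ → ℂ := fun x => (x : ℂ) ^ (w - 1) * φ x with hθ
  set θ' : ℝ → ℂ := fun x => (w - 1) * (x : ℂ) ^ (w - 1 - 1) * φ x + (x : ℂ) ^ (w - 1) * φ' x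
    with hθ'
  have hpow : ∀ (z : ℂ) (x : ℝ), 0 < x →
      HasDerivAt (fun x : ℝ => (x : ℂ) ^ z) (z * (x : ℂ) ^ (z - 1)) x := fun z x hx => by
    have h1 : HasDerivAt (fun u : ℂ => u ^ z) (z * (x : ℂ) ^ (z - 1)) (x : ℂ) := by
      have := (hasDerivAt_id (x : ℂ)).cpow_const (c := z) (Or.inl (by simpa using hx))
      simpa using this
    exact h1.comp_ofReal
  have hd : ∀ x, 0 < x → HasDerivAt θ (θ' x) x := fun x hx =>
    (hpow (w - 1) x hx).mul (h.hasDerivAt x hx)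
  have hpc : ∀ z : ℂ, ContinuousOn (fun x : ℝ => (x : ℂ) ^ z) (Ioi 0) := fun z x hx =>
    (hpow z x hx).continuousAt.continuousWithinAt
  have hcont : ContinuousOn θ' (Ioi 0) :=
    ((continuousOn_const.mul (hpc _)).mul h.continuousOn).add ((hpc _).mul h.continuousOn_deriv)
  have hθi : IntegrableOn θ (Ioi 0) := hc
  have hθi2 : IntegrableOn θ (Ici (Real.log 2)) := by
    rw [integrableOn_Ici_iff_integrableOn_Ioi]
    exact hθi.mono_set (Ioi_subset_Ioi hl2.le)
  set R : ℝ → ℂ := fun x => ((ceilGap x * Real.exp (-x) : ℝ) : ℂ) * (θ' x - θ x) with hR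
  set R₁ : ℝ → ℂ := fun x => (x : ℂ) ^ (w - 1) *
    (((ceilGap x * Real.exp (-x) : ℝ) : ℂ) * (φ' x - φ x)) with hR₁
  set R₂ : ℝ → ℂ := fun x => (x : ℂ) ^ (w - 1 - 1) *
    (((ceilGap x * Real.exp (-x) : ℝ) : ℂ) * φ x) with hR₂
  -- The product rule separates the derivative of the power, which lowers the Mellin exponent to `w
  -- - 1`, from the derivative of the amplitude.
  have hRe : R = fun x => R₁ x + (w - 1) * R₂ x := by
    funext x
    simp only [hR, hR₁, hR₂, hθ, hθ']
    ring
  have hi1 : IntegrableOn R₁ (Ici (Real.log 2)) :=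
    (h.mellin_gapDeriv w).1.integrableOn_Ici_of_indicator
  have hi2 : IntegrableOn R₂ (Ici (Real.log 2)) :=
    (h.mellin_gapValue (w - 1)).1.integrableOn_Ici_of_indicator
  have hRi : IntegrableOn R (Ici (Real.log 2)) := by
    rw [hRe]
    exact hi1.add (hi2.const_mul _)
  have hRv : ∫ x in Ici (Real.log 2), R x =
      mellin (gapDeriv φ φ') w + (w - 1) * mellin (gapValue φ) (w - 1) := by
    rw [hRe, integral_add hi1 (hi2.const_mul _), integral_const_mul]
    simp only [hR₁, hR₂]
    rw [setIntegral_Ici_eq_mellin, setIntegral_Ici_eq_mellin]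
    rfl
  have s1 := hasSum_integral_iUnion (f := θ)
    (fun n : IndexTwo => measurableSet_Ico) pairwise_disjoint_Ico_log
    (by rw [iUnion_Ico_log]; exact hθi2)
  have s2 := hasSum_integral_iUnion (f := R)
    (fun n : IndexTwo => measurableSet_Ico) pairwise_disjoint_Ico_log
    (by rw [iUnion_Ico_log]; exact hRi)
  rw [iUnion_Ico_log] at s1 s2
  have s3 := s1.sub s2
  have hmel : mellin φ w = (∫ x in Ioc 0 (Real.log 2), θ x) + ∫ x in Ici (Real.log 2), θ x := by
    rw [integral_Ici_eq_integral_Ioi, ← setIntegral_union (Ioc_disjoint_Ioi le_rfl)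
      measurableSet_Ioi (hθi.mono_set Ioc_subset_Ioi_self)
      (hθi.mono_set (Ioi_subset_Ioi hl2.le)), Ioc_union_Ioi_eq_Ioi hl2.le]
    rfl
  have hval : mellin φ w + mellinDiscrepancy φ φ' w =
      (∫ x in Ici (Real.log 2), θ x) - ∫ x in Ici (Real.log 2), R x := by
    rw [hRv, hmel, mellinDiscrepancy, mellin_indicator measurableSet_Iic, Ioi_inter_Iic]
    ring
  rw [hval]
  refine s3.congr_fun fun n => ?_
  rw [setIntegral_Ico_log_eq n hd hcont, add_sub_cancel_right]

/-! ### The Mellin transform of the Carleman kernel -/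

theorem mellinConvergent_inv_one_add {w : ℂ} (hw0 : 0 < w.re) (hw1 : w.re < 1) :
    MellinConvergent (fun x : ℝ => ((1 / (1 + x) : ℝ) : ℂ)) w := by
  have hc : ContinuousOn (fun x : ℝ => ((1 / (1 + x) : ℝ) : ℂ)) (Ioi 0) := by
    refine Complex.continuous_ofReal.comp_continuousOn ?_
    refine continuousOn_const.div (by fun_prop) fun x hx => ?_
    have : (0 : ℝ) < x := hx
    positivity
  refine mellinConvergent_of_isBigO_rpow (a := 1) (b := 0)
    (hc.locallyIntegrableOn measurableSet_Ioi) ?_ hw1 ?_ hw0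
  · refine Asymptotics.IsBigO.of_bound 1 ?_
    filter_upwards [Filter.eventually_gt_atTop 0] with x hx
    rw [Complex.norm_real, Real.norm_of_nonneg (by positivity), Real.rpow_neg_one,
      Real.norm_of_nonneg (by positivity), one_mul, one_div]
    exact inv_anti₀ hx (by linarith)
  · refine Asymptotics.IsBigO.of_bound 1 ?_
    filter_upwards [self_mem_nhdsWithin] with x hx
    have hx : (0 : ℝ) < x := hx
    rw [Complex.norm_real, Real.norm_of_nonneg (by positivity)]
    simp only [neg_zero, Real.rpow_zero, norm_one, mul_one]
    rw [div_le_one (by positivity)]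
    linarith

/-- The Mellin transform of `1 / (1 + x)`. -/
theorem mellin_inv_one_add {w : ℂ} (hw0 : 0 < w.re) (hw1 : w.re < 1) :
    mellin (fun x : ℝ => ((1 / (1 + x) : ℝ) : ℂ)) w = Real.pi / Complex.sin (Real.pi * w) := by
  -- Writing `1/(1+x)` as `∫ e^{-(1+x)u} du` and exchanging the integrals gives `Γ(w) Γ(1-w)`, to
  -- which the reflection formula applies.
  set G : ℝ → ℝ → ℂ := fun x u => (x : ℂ) ^ (w - 1) * ((Real.exp (-(1 + x) * u) : ℝ) : ℂ) with hG
  have hinner : ∀ x : ℝ, 0 < x → ∫ u in Ioi (0 : ℝ), Real.exp (-(1 + x) * u) = 1 / (1 + x) :=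
    fun x hx => by
      rw [integral_exp_mul_Ioi (by linarith), mul_zero, Real.exp_zero, neg_div_neg_eq]
  have hmeas : AEStronglyMeasurable (Function.uncurry G)
      ((volume.restrict (Ioi 0)).prod (volume.restrict (Ioi (0 : ℝ)))) := by
    refine AEStronglyMeasurable.mul ?_ ?_
    · refine Measurable.aestronglyMeasurable ?_
      exact (Complex.measurable_ofReal.comp measurable_fst).pow_const _
    · refine Continuous.aestronglyMeasurable ?_
      fun_prop
  have hint : Integrable (Function.uncurry G)
      ((volume.restrict (Ioi 0)).prod (volume.restrict (Ioi (0 : ℝ)))) := by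
    rw [integrable_prod_iff hmeas]
    constructor
    · refine (ae_restrict_iff' measurableSet_Ioi).2 (Filter.Eventually.of_forall fun x hx => ?_)
      have hx : (0 : ℝ) < x := hx
      have h1 := integrableOn_exp_mul_Ioi (show -(1 + x) < 0 by linarith) 0
      exact (Integrable.ofReal (𝕜 := ℂ) h1).const_mul ((x : ℂ) ^ (w - 1))
    · refine ((mellinConvergent_inv_one_add hw0 hw1).norm).congr ?_
      refine (ae_restrict_iff' measurableSet_Ioi).2 (Filter.Eventually.of_forall fun x hx => ?_)
      have hx : (0 : ℝ) < x := hx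
      simp only [Function.uncurry, hG, norm_mul, norm_smul, Complex.norm_real]
      rw [integral_const_mul, Real.norm_of_nonneg (by positivity : 0 ≤ 1 / (1 + x)), ← hinner x hx]
      congr 1
      exact integral_congr_ae (Filter.Eventually.of_forall fun u =>
        (Real.norm_of_nonneg (Real.exp_pos _).le).symm)
  have hswap := integral_integral_swap hint
  have hleft : ∀ x ∈ Ioi (0 : ℝ), ∫ u in Ioi (0 : ℝ), G x u =
      (x : ℂ) ^ (w - 1) • ((1 / (1 + x) : ℝ) : ℂ) := fun x hx => by
    simp only [hG]
    rw [integral_const_mul, integral_complex_ofReal, hinner x hx, smul_eq_mul]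
  have hright : ∀ u ∈ Ioi (0 : ℝ), ∫ x in Ioi (0 : ℝ), G x u =
      Complex.Gamma w * ((u : ℂ) ^ ((1 - w) - 1) * Complex.exp (-(((1 : ℝ) : ℂ) * u))) :=
    fun u hu => by
      have hu : (0 : ℝ) < u := hu
      have h1 := Complex.integral_cpow_mul_exp_neg_mul_Ioi hw0 hu
      have h2 : ∀ x : ℝ, G x u = Complex.exp (-u) * ((x : ℂ) ^ (w - 1) *
          Complex.exp (-((u : ℂ) * x))) := fun x => by
        simp only [hG]
        push_cast
        rw [mul_left_comm, ← Complex.exp_add]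
        ring_nf
      simp_rw [h2]
      rw [integral_const_mul, h1, one_div, Complex.inv_cpow _ _ (by
        rw [Complex.arg_ofReal_of_nonneg hu.le]
        exact Real.pi_pos.ne), sub_sub_cancel_left, Complex.cpow_neg]
      push_cast
      ring_nf
  rw [mellin, ← setIntegral_congr_fun measurableSet_Ioi hleft, hswap,
    setIntegral_congr_fun measurableSet_Ioi hright, integral_const_mul,
    Complex.integral_cpow_mul_exp_neg_mul_Ioi (by simpa using hw1) one_pos,
    ← Complex.Gamma_mul_Gamma_one_sub]
  simp

theorem inv_add_eq_comp {y : ℝ} (hy : 0 < y) :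
    (fun x : ℝ => ((1 / (x + y) : ℝ) : ℂ)) =
      fun x => (y : ℂ)⁻¹ • ((1 / (1 + y⁻¹ * x) : ℝ) : ℂ) := by
  funext x
  rw [smul_eq_mul, ← Complex.ofReal_inv, ← Complex.ofReal_mul]
  congr 1
  rw [← div_eq_inv_mul, div_div]
  congr 1
  field_simp
  ring

theorem mellinConvergent_inv_add {y : ℝ} (hy : 0 < y) {w : ℂ} (hw0 : 0 < w.re)
    (hw1 : w.re < 1) : MellinConvergent (fun x : ℝ => ((1 / (x + y) : ℝ) : ℂ)) w := by
  rw [inv_add_eq_comp hy]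
  exact ((MellinConvergent.comp_mul_left (inv_pos.2 hy)).2
    (mellinConvergent_inv_one_add hw0 hw1)).const_smul _

/-- The Mellin transform of `1 / (x + y)`. -/
theorem mellin_inv_add {y : ℝ} (hy : 0 < y) {w : ℂ} (hw0 : 0 < w.re) (hw1 : w.re < 1) :
    mellin (fun x : ℝ => ((1 / (x + y) : ℝ) : ℂ)) w =
      (y : ℂ) ^ (w - 1) * (Real.pi / Complex.sin (Real.pi * w)) := by
  have hy0 : (y : ℂ) ≠ 0 := by exact_mod_cast hy.ne'
  rw [inv_add_eq_comp hy, mellin_const_smul,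
    mellin_comp_mul_left (fun x : ℝ => ((1 / (1 + x) : ℝ) : ℂ)) w (inv_pos.2 hy),
    mellin_inv_one_add hw0 hw1, smul_eq_mul, smul_eq_mul, Complex.ofReal_inv,
    Complex.inv_cpow _ _ (by
      rw [Complex.arg_ofReal_of_nonneg hy.le]
      exact Real.pi_pos.ne), Complex.cpow_neg, inv_inv, Complex.cpow_sub _ _ hy0,
    Complex.cpow_one]
  ring

/-- The modulus of the integrand is the same integrand at the real exponent `Re w`. -/
theorem integral_norm_cpow_smul_inv_add {y : ℝ} (hy : 0 < y) {w : ℂ} (hw0 : 0 < w.re)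
    (hw1 : w.re < 1) :
    ∫ x in Ioi (0 : ℝ), ‖(x : ℂ) ^ (w - 1) • ((1 / (x + y) : ℝ) : ℂ)‖ =
      y ^ (w.re - 1) * (Real.pi / Real.sin (Real.pi * w.re)) := by
  have h1 := mellin_inv_add hy (w := (w.re : ℂ)) (by simpa using hw0) (by simpa using hw1)
  have h2 : ∀ x ∈ Ioi (0 : ℝ), (x : ℂ) ^ ((w.re : ℂ) - 1) • ((1 / (x + y) : ℝ) : ℂ) =
      ((‖(x : ℂ) ^ (w - 1) • ((1 / (x + y) : ℝ) : ℂ)‖ : ℝ) : ℂ) := fun x hx => by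
    have hx' : (0 : ℝ) < x := hx
    rw [norm_smul, Complex.norm_cpow_eq_rpow_re_of_pos hx', Complex.norm_real,
      Real.norm_of_nonneg (by positivity), Complex.ofReal_mul, Complex.ofReal_cpow hx'.le]
    simp
  rw [mellin, setIntegral_congr_fun measurableSet_Ioi h2, integral_complex_ofReal] at h1
  have h3 : (y : ℂ) ^ ((w.re : ℂ) - 1) * (Real.pi / Complex.sin (Real.pi * (w.re : ℂ))) =
      ((y ^ (w.re - 1) * (Real.pi / Real.sin (Real.pi * w.re)) : ℝ) : ℂ) := by
    push_cast
    rw [Complex.ofReal_cpow hy.le]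
    push_cast
    rfl
  rw [h3] at h1
  exact_mod_cast h1

/-! ### Approximate eigenvectors and points of the spectrum -/

/-- The gain `1/y` in the amplitude matters: with `y = log m` it makes the summation error in row
`m` of size `1/(√m log m)`, which is square-summable. -/
theorem tameAmplitude_inv_add {y : ℝ} (hy : 0 < y) :
    TameAmplitude (fun x : ℝ => ((1 / (x + y) : ℝ) : ℂ))
      (fun x : ℝ => ((-1 / (x + y) ^ 2 : ℝ) : ℂ)) (2 / y) where
  hasDerivAt x hx := by
    have h := ((hasDerivAt_id x).add_const y).inv (by simp only [id]; positivity)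
    have h2 := h.ofReal_comp
    simpa [one_div] using h2
  continuousOn_deriv := by
    refine Complex.continuous_ofReal.comp_continuousOn ?_
    refine continuousOn_const.div (by fun_prop) fun x hx => ?_
    have : (0 : ℝ) < x := hx
    positivity
  norm_le x hx := by
    rw [Complex.norm_real, Real.norm_of_nonneg (by positivity), div_le_div_iff₀ (by positivity) hy]
    linarith
  norm_deriv_le x hx := by
    have hx0 : (1 / 2 : ℝ) ≤ x := by linarith [Real.log_two_gt_d9]
    rw [Complex.norm_real, neg_div, norm_neg, Real.norm_of_nonneg (by positivity),
      div_le_div_iff₀ (by positivity) hy]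
    nlinarith

/-- The sequences `(log n)^{w-1} / √n`, which are approximate eigenvectors of the multiplicative
Hilbert matrix. -/
theorem memℓp_logPower {w : ℂ} (hw : -(1 / 2) ≤ w.re) (hw' : w.re < 1 / 2) :
    (Summable fun n : IndexTwo =>
      ‖((Real.log (n : ℕ) : ℝ) : ℂ) ^ (w - 1) / ((√((n : ℕ) : ℝ) : ℝ) : ℂ)‖ ^ 2) ∧
    ∑' n : IndexTwo, ‖((Real.log (n : ℕ) : ℝ) : ℂ) ^ (w - 1) / ((√((n : ℕ) : ℝ) : ℝ) : ℂ)‖ ^ 2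
      ≤ 6 / (1 / 2 - w.re) := by
  have h := tsum_log_rpow_div_le (δ := 1 / 2 - w.re) (by linarith) (by linarith)
  have e : ∀ n : IndexTwo, Real.log (n : ℕ) ^ (-1 - 2 * (1 / 2 - w.re)) / ((n : ℕ) : ℝ) =
      ‖((Real.log (n : ℕ) : ℝ) : ℂ) ^ (w - 1) / ((√((n : ℕ) : ℝ) : ℝ) : ℂ)‖ ^ 2 := fun n => by
    rw [norm_div, Complex.norm_cpow_eq_rpow_re_of_pos n.log_pos, Complex.norm_real,
      Real.norm_of_nonneg (Real.sqrt_nonneg _), div_pow, Real.sq_sqrt n.pos.le,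
      ← Real.rpow_natCast, ← Real.rpow_mul n.log_pos.le]
    congr 2
    rw [Complex.sub_re, Complex.one_re]
    push_cast
    ring
  simp_rw [e] at h
  exact h

/-- The sequence `(log n)^{w-1} / √n`, an approximate eigenvector of the multiplicative Hilbert
matrix when `Re w` is close to `1/2`. -/
noncomputable def logPower (w : ℂ) (hw : -(1 / 2) ≤ w.re ∧ w.re < 1 / 2) : DirichletH20 :=
  ⟨fun n => ((Real.log (n : ℕ) : ℝ) : ℂ) ^ (w - 1) / ((√((n : ℕ) : ℝ) : ℝ) : ℂ),
    memℓp_two_of_summable_sq (memℓp_logPower hw.1 hw.2).1⟩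

theorem logPower_apply {w : ℂ} (hw : -(1 / 2) ≤ w.re ∧ w.re < 1 / 2) (n : IndexTwo) :
    logPower w hw n = ((Real.log (n : ℕ) : ℝ) : ℂ) ^ (w - 1) / ((√((n : ℕ) : ℝ) : ℝ) : ℂ) := rfl

theorem norm_logPower_sq_le {w : ℂ} (hw : -(1 / 2) ≤ w.re ∧ w.re < 1 / 2) :
    ‖logPower w hw‖ ^ 2 ≤ 6 / (1 / 2 - w.re) := by
  rw [lp_two_norm_sq]
  exact (memℓp_logPower hw.1 hw.2).2

theorem multHilbertMatrix_mul_eq (m n : IndexTwo) (z : ℂ) :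
    (multHilbertMatrix m n : ℂ) * (z / ((√((n : ℕ) : ℝ) : ℝ) : ℂ)) =
      (1 / ((√((m : ℕ) : ℝ) : ℝ) : ℂ)) *
        (z * ((1 / (Real.log (n : ℕ) + Real.log (m : ℕ)) : ℝ) : ℂ) / ((n : ℕ) : ℂ)) := by
  rw [multHilbertMatrix_apply]
  have e : (((n : ℕ) : ℝ) : ℂ) = ((√((n : ℕ) : ℝ) : ℝ) : ℂ) * ((√((n : ℕ) : ℝ) : ℝ) : ℂ) := by
    rw [← Complex.ofReal_mul, Real.mul_self_sqrt n.pos.le]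
  rw [Complex.ofReal_natCast] at e
  rw [e]
  push_cast
  simp only [div_eq_mul_inv, mul_inv, one_mul]
  ring

/-- The action of the operator on `logPower w` is multiplication by `π / sin (π w)`, up to an
error bounded in norm. -/
theorem multHilbertOperator_logPower {w : ℂ} (hw : 1 / 4 ≤ w.re) (hw' : w.re < 1 / 2) :
    ‖multHilbertOperator (logPower w ⟨by linarith, hw'⟩) -
      (Real.pi / Complex.sin (Real.pi * w) : ℂ) • logPower w ⟨by linarith, hw'⟩‖ ≤
      40 * (1 + ‖w‖) * ‖logPower 0 (by norm_num)‖ := by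
  set a := logPower w ⟨by linarith, hw'⟩ with ha
  set e := logPower 0 (by norm_num) with he
  -- Row `m` is `1/√m` times a sum over `log n` with amplitude `1/(x + log m)`. The Mellin transform
  -- in Euler summation yields the factor `π / sin (π w)`, and the discrepancy is the whole error.
  have hval : ∀ m : IndexTwo, multHilbertOperator a m - Real.pi / Complex.sin (Real.pi * w) * a m =
      1 / ((√((m : ℕ) : ℝ) : ℝ) : ℂ) * mellinDiscrepancy
        (fun x : ℝ => ((1 / (x + Real.log (m : ℕ)) : ℝ) : ℂ))
        (fun x : ℝ => ((-1 / (x + Real.log (m : ℕ)) ^ 2 : ℝ) : ℂ)) w := fun m => by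
    have h1 := ((tameAmplitude_inv_add m.log_pos).hasSum_mellin
      (mellinConvergent_inv_add m.log_pos (w := w) (by linarith) (by linarith))).mul_left
      (1 / ((√((m : ℕ) : ℝ) : ℝ) : ℂ))
    have h2 : HasSum (fun n => (multHilbertMatrix m n : ℂ) * a n) _ := h1.congr_fun fun n => by
      rw [ha, logPower_apply, multHilbertMatrix_mul_eq]
    rw [(hasSum_multHilbertOperator a m).unique h2,
      mellin_inv_add m.log_pos (by linarith) (by linarith), ha, logPower_apply]
    ring
  have hle : ∀ m : IndexTwo, ‖(multHilbertOperator a -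
      (Real.pi / Complex.sin (Real.pi * w) : ℂ) • a) m‖ ≤ 40 * (1 + ‖w‖) * ‖e m‖ := fun m => by
    have h1 : (multHilbertOperator a - (Real.pi / Complex.sin (Real.pi * w) : ℂ) • a) m =
      multHilbertOperator a m - Real.pi / Complex.sin (Real.pi * w) * a m := rfl
    have h2 := (tameAmplitude_inv_add m.log_pos).norm_mellinDiscrepancy_le hw (by linarith)
    have h3 : ‖e m‖ = 1 / √((m : ℕ) : ℝ) * (1 / Real.log (m : ℕ)) := by
      rw [he, logPower_apply, norm_div, Complex.norm_cpow_eq_rpow_re_of_pos m.log_pos,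
        Complex.norm_real, Real.norm_of_nonneg (Real.sqrt_nonneg _)]
      simp only [zero_sub, Complex.neg_re, Complex.one_re, Real.rpow_neg_one]
      rw [div_eq_mul_inv, mul_comm, one_div, one_div]
    rw [h1, hval, norm_mul, h3, norm_div, norm_one, Complex.norm_real,
      Real.norm_of_nonneg (Real.sqrt_nonneg _)]
    calc _ ≤ 1 / √((m : ℕ) : ℝ) * (20 * (2 / Real.log (m : ℕ)) * (1 + ‖w‖)) := by gcongr
      _ = _ := by ring
  refine le_of_sq_le_sq ?_ (by positivity)
  rw [mul_pow, lp_two_norm_sq, lp_two_norm_sq, ← tsum_mul_left]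
  refine (lp_two_summable_sq _).tsum_le_tsum (fun m => ?_) ((lp_two_summable_sq e).mul_left _)
  rw [← mul_pow]
  exact pow_le_pow_left₀ (norm_nonneg _) (hle m) 2

theorem sin_pi_mul_half_add_mul_I (β : ℝ) :
    Complex.sin (Real.pi * ((1 / 2 : ℝ) + β * Complex.I)) = (Real.cosh (Real.pi * β) : ℂ) := by
  rw [show (Real.pi : ℂ) * ((1 / 2 : ℝ) + β * Complex.I) =
    (Real.pi / 2 : ℂ) + (Real.pi * β : ℂ) * Complex.I by push_cast; ring,
    Complex.sin_add_mul_I, Complex.sin_pi_div_two, Complex.cos_pi_div_two]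
  push_cast
  ring

/-- The values `π / cosh (π β)` belong to the spectrum. -/
theorem pi_div_cosh_mem_spectrum (β : ℝ) :
    ((Real.pi / Real.cosh (Real.pi * β) : ℝ) : ℂ) ∈ spectrum ℂ multHilbertOperator := by
  set l : ℂ := ((Real.pi / Real.cosh (Real.pi * β) : ℝ) : ℂ) with hl
  by_contra hmem
  rw [spectrum.notMem_iff] at hmem
  obtain ⟨U, hU⟩ := hmem
  set R : DirichletH20 →L[ℂ] DirichletH20 := ↑U⁻¹ with hR
  have hinv : ∀ x, R (l • x - multHilbertOperator x) = x := fun x => by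
    have h1 : R * (U : DirichletH20 →L[ℂ] DirichletH20) = 1 := U.inv_mul
    have h2 := congrArg (fun T : DirichletH20 →L[ℂ] DirichletH20 => T x) h1
    rw [hU] at h2
    simpa [Algebra.algebraMap_eq_smul_one] using h2
  set W : ℝ → ℂ := fun δ => ((1 / 2 - δ : ℝ) : ℂ) + β * Complex.I with hW
  have hWre : ∀ δ, (W δ).re = 1 / 2 - δ := fun δ => by simp [hW]
  have hWc : Continuous W := by fun_prop
  -- The factor `2` absorbs the term `‖R‖ ‖l - z‖ ‖a‖`, which is at most `‖a‖ / 2` for small `δ`.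
  -- The factor `2 + |β|` dominates `1 + ‖W δ‖`.
  set B : ℝ := 2 * (‖R‖ * (40 * (2 + |β|) * ‖logPower 0 (by norm_num)‖)) with hB
  have hz : Filter.Tendsto (fun δ => ‖R‖ * ‖l - Real.pi / Complex.sin (Real.pi * W δ)‖)
      (nhdsWithin 0 (Ioi 0)) (nhds 0) := by
    have hs : Complex.sin (Real.pi * W 0) = (Real.cosh (Real.pi * β) : ℂ) := by
      rw [← sin_pi_mul_half_add_mul_I]
      simp [hW]
    have hne : Complex.sin (Real.pi * W 0) ≠ 0 := by
      rw [hs]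
      exact_mod_cast (Real.cosh_pos _).ne'
    have hc : ContinuousAt (fun δ => ‖R‖ * ‖l - Real.pi / Complex.sin (Real.pi * W δ)‖) 0 := by
      refine continuousAt_const.mul (ContinuousAt.norm (continuousAt_const.sub
        (continuousAt_const.div ?_ hne)))
      exact (Complex.continuous_sin.comp (continuous_const.mul hWc)).continuousAt
    have h0 : ‖R‖ * ‖l - Real.pi / Complex.sin (Real.pi * W 0)‖ = 0 := by
      rw [hs, hl]
      push_cast
      simp
    have := hc.tendsto
    rw [h0] at this
    exact this.mono_left nhdsWithin_le_nhds
  -- A bounded resolvent at `l` would keep the norms of the approximate eigenvectors bounded as `δ →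
  -- 0`. Finite partial sums are used so that the limit in `δ` can be taken term by term.
  have hbound : ∀ᶠ δ in nhdsWithin (0 : ℝ) (Ioi 0), ∀ s : Finset IndexTwo,
      ∑ n ∈ s, Real.log (n : ℕ) ^ (-1 - 2 * δ) / ((n : ℕ) : ℝ) ≤ B ^ 2 := by
    have hs : Ioo (0 : ℝ) (1 / 4) ∈ nhdsWithin (0 : ℝ) (Ioi 0) := Ioo_mem_nhdsGT (by norm_num)
    filter_upwards [hs, hz.eventually (gt_mem_nhds (by norm_num : (0 : ℝ) < 1 / 2))] with δ hδ hsm s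
    have hw1 : 1 / 4 ≤ (W δ).re := by rw [hWre]; linarith [hδ.2]
    have hw2 : (W δ).re < 1 / 2 := by rw [hWre]; linarith [hδ.1]
    set a := logPower (W δ) ⟨by linarith, hw2⟩ with ha
    have h1 := multHilbertOperator_logPower hw1 hw2
    rw [← ha] at h1
    set z : ℂ := Real.pi / Complex.sin (Real.pi * W δ) with hzdef
    have h2 : l • a - multHilbertOperator a = (l - z) • a - (multHilbertOperator a - z • a) := by
      rw [sub_smul]
      abel
    have hWn : ‖W δ‖ ≤ 1 + |β| := by
      refine (norm_add_le _ _).trans (add_le_add ?_ ?_)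
      · rw [Complex.norm_real, Real.norm_of_nonneg (by linarith [hδ.2])]
        linarith [hδ.1]
      · rw [norm_mul, Complex.norm_I, mul_one, Complex.norm_real, Real.norm_eq_abs]
    have h3 : ‖a‖ ≤ ‖R‖ * (‖l - z‖ * ‖a‖ + 40 * (1 + ‖W δ‖) * ‖logPower 0 (by norm_num)‖) := by
      calc ‖a‖ = ‖R (l • a - multHilbertOperator a)‖ := by rw [hinv]
        _ ≤ ‖R‖ * ‖l • a - multHilbertOperator a‖ := R.le_opNorm _
        _ ≤ _ := by
          rw [h2]
          gcongr
          refine (norm_sub_le _ _).trans (add_le_add (norm_smul_le _ _) h1)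
    have h4 : ‖a‖ ≤ B := by
      have h5 : ‖R‖ * (40 * (1 + ‖W δ‖) * ‖logPower 0 (by norm_num)‖) ≤
          ‖R‖ * (40 * (2 + |β|) * ‖logPower 0 (by norm_num)‖) := by
        gcongr ‖R‖ * (40 * ?_ * _)
        linarith
      have h6 : ‖R‖ * ‖l - z‖ * ‖a‖ ≤ 1 / 2 * ‖a‖ := by gcongr
      rw [hB]
      linarith
    calc ∑ n ∈ s, Real.log (n : ℕ) ^ (-1 - 2 * δ) / ((n : ℕ) : ℝ) = ∑ n ∈ s, ‖a n‖ ^ 2 := by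
          refine Finset.sum_congr rfl fun n _ => ?_
          rw [ha, logPower_apply, norm_div, Complex.norm_cpow_eq_rpow_re_of_pos n.log_pos,
            Complex.norm_real, Real.norm_of_nonneg (Real.sqrt_nonneg _), div_pow,
            Real.sq_sqrt n.pos.le, ← Real.rpow_natCast, ← Real.rpow_mul n.log_pos.le]
          congr 2
          rw [Complex.sub_re, Complex.one_re, hWre]
          push_cast
          ring
      _ ≤ ∑' n, ‖a n‖ ^ 2 := (lp_two_summable_sq a).sum_le_tsum _ fun _ _ => sq_nonneg _
      _ = ‖a‖ ^ 2 := (lp_two_norm_sq a).symm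
      _ ≤ B ^ 2 := pow_le_pow_left₀ (norm_nonneg _) h4 2
  refine not_summable_inv_mul_log (summable_of_sum_le (c := B ^ 2) (fun n => ?_) fun s => ?_)
  · have := n.log_pos
    have := n.pos
    positivity
  · have ht : Filter.Tendsto
        (fun δ : ℝ => ∑ n ∈ s, Real.log (n : ℕ) ^ (-1 - 2 * δ) / ((n : ℕ) : ℝ))
        (nhdsWithin 0 (Ioi 0)) (nhds (∑ n ∈ s, 1 / (((n : ℕ) : ℝ) * Real.log (n : ℕ)))) := by
      have hc : Continuous
          fun δ : ℝ => ∑ n ∈ s, Real.log (n : ℕ) ^ (-1 - 2 * δ) / ((n : ℕ) : ℝ) := by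
        refine continuous_finsetSum _ fun n _ => Continuous.div_const ?_ _
        exact Continuous.rpow continuous_const (by fun_prop) fun _ => Or.inl n.log_pos.ne'
      have h0 := hc.tendsto 0
      have e : ∀ n : IndexTwo, Real.log (n : ℕ) ^ (-1 - 2 * (0 : ℝ)) / ((n : ℕ) : ℝ) =
          1 / (((n : ℕ) : ℝ) * Real.log (n : ℕ)) := fun n => by
        rw [mul_zero, sub_zero, Real.rpow_neg_one, one_div, mul_inv, div_eq_mul_inv, mul_comm]
      simp_rw [e] at h0
      exact h0.mono_left nhdsWithin_le_nhds
    exact le_of_tendsto ht (hbound.mono fun δ h => h s)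

/-! ### The factor `l sin (π w) - π` and shifts of vertical lines -/

theorem Complex.sin_pi_mul_re_im (w : ℂ) :
    (Complex.sin (Real.pi * w)).re = Real.sin (Real.pi * w.re) * Real.cosh (Real.pi * w.im) ∧
    (Complex.sin (Real.pi * w)).im = Real.cos (Real.pi * w.re) * Real.sinh (Real.pi * w.im) := by
  have e : (Real.pi : ℂ) * w = ((Real.pi * w.re : ℝ) : ℂ) + ((Real.pi * w.im : ℝ) : ℂ) * I := by
    conv_lhs => rw [← Complex.re_add_im w]
    push_cast
    ring
  rw [e, Complex.sin_add_mul_I, ← Complex.ofReal_sin, ← Complex.ofReal_cosh, ← Complex.ofReal_cos,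
    ← Complex.ofReal_sinh]
  constructor <;> simp only [Complex.add_re, Complex.add_im, Complex.mul_re, Complex.mul_im,
    Complex.ofReal_re, Complex.ofReal_im, Complex.I_re, Complex.I_im] <;> ring

theorem Complex.abs_sinh_le_norm_sin_pi_mul (w : ℂ) :
    |Real.sinh (Real.pi * w.im)| ≤ ‖Complex.sin (Real.pi * w)‖ := by
  obtain ⟨h1, h2⟩ := Complex.sin_pi_mul_re_im w
  rw [← abs_of_nonneg (norm_nonneg (Complex.sin (Real.pi * w)))]
  refine sq_le_sq.1 ?_
  rw [Complex.sq_norm, Complex.normSq_apply, h1, h2]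
  nlinarith [Real.sin_sq_add_cos_sq (Real.pi * w.re), Real.cosh_sq (Real.pi * w.im),
    sq_nonneg (Real.sin (Real.pi * w.re))]

/-- The quartic term of the exponential series suffices, since `π⁴/24 ≥ 81/24`. A fourth power in
the denominator beats the linear growth of the discrepancy and leaves more than quadratic decay. -/
theorem pow_four_le_sinh_pi_mul {t : ℝ} (ht : 1 ≤ t) : t ^ 4 ≤ Real.sinh (Real.pi * t) := by
  have hp := Real.pi_gt_three
  have h0 : 0 ≤ Real.pi * t := by positivity
  have h1 := Real.pow_div_factorial_le_exp (Real.pi * t) h0 4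
  have h2 : Real.exp (-(Real.pi * t)) ≤ 1 := Real.exp_le_one_iff.2 (by linarith)
  have h3 : (81 : ℝ) ≤ Real.pi ^ 4 := by nlinarith [sq_nonneg (Real.pi ^ 2 - 9)]
  have h4 : (1 : ℝ) ≤ t ^ 4 := one_le_pow₀ ht
  have h5 : ((Nat.factorial 4 : ℕ) : ℝ) = 24 := by norm_num [Nat.factorial]
  rw [h5, mul_pow] at h1
  rw [Real.sinh_eq]
  nlinarith

/-- The zeros of `l sin (π w) - π` in the strip `0 < Re w < 5/2` lie on the line `Re w = 1/2`
when `0 < l ≤ π`. -/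
theorem re_eq_half_of_mul_sin_eq {l : ℝ} (hl : 0 < l) (hl' : l ≤ Real.pi) {w : ℂ}
    (hw0 : 0 < w.re) (hw1 : w.re < 5 / 2) (h : l * Complex.sin (Real.pi * w) - Real.pi = 0) :
    w.re = 1 / 2 := by
  obtain ⟨h1, h2⟩ := Complex.sin_pi_mul_re_im w
  have h := sub_eq_zero.1 h
  have hre := congrArg Complex.re h
  have him := congrArg Complex.im h
  rw [Complex.re_ofReal_mul, h1, Complex.ofReal_re] at hre
  rw [Complex.im_ofReal_mul, h2, Complex.ofReal_im] at him
  have hcosh := Real.one_le_cosh (Real.pi * w.im)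
  -- The imaginary part forces `cos = 0` or `sinh = 0`. In the first case the real part selects `sin
  -- = 1`; in the second `sin = π / l ≥ 1`, which is where `l ≤ π` enters. The next solution after
  -- `1/2` is `5/2`, which fixes the width of the strip.
  have hsin : Real.sin (Real.pi * w.re) = 1 := by
    have hle := Real.sin_le_one (Real.pi * w.re)
    rcases mul_eq_zero.1 ((mul_eq_zero.1 him).resolve_left hl.ne') with hc | hs
    · have hsq := Real.sin_sq_add_cos_sq (Real.pi * w.re)
      rw [hc] at hsq
      have hpos : 0 < Real.sin (Real.pi * w.re) := by
        by_contra hneg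
        have : l * (Real.sin (Real.pi * w.re) * Real.cosh (Real.pi * w.im)) ≤ 0 :=
          mul_nonpos_of_nonneg_of_nonpos hl.le
            (mul_nonpos_of_nonpos_of_nonneg (not_lt.1 hneg) (by linarith))
        linarith [Real.pi_pos]
      nlinarith
    · rw [Real.sinh_eq_zero.1 hs, Real.cosh_zero, mul_one] at hre
      nlinarith
  obtain ⟨k, hk⟩ := Real.sin_eq_one_iff.1 hsin
  have hk' : w.re = 1 / 2 + 2 * k := by
    have := Real.pi_pos.ne'
    field_simp at hk
    linarith
  rw [hk'] at hw0 hw1 ⊢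
  have k0 : (-1 : ℝ) < k := by linarith
  have k1 : (k : ℝ) < 1 := by linarith
  have : k = 0 := by
    have a : -1 < k := by exact_mod_cast k0
    have b : k < 1 := by exact_mod_cast k1
    omega
  simp [this]

/-- The sine is at least `w.im ^ 4` in modulus, and the second hypothesis lets half of `l * w.im ^
4` absorb the constant `π`. -/
theorem norm_mul_sin_sub_pi_ge {l : ℝ} (hl : 0 < l) {w : ℂ} (h1 : 1 ≤ |w.im|)
    (h2 : 2 * Real.pi / l ≤ |w.im|) :
    l / 2 * w.im ^ 4 ≤ ‖l * Complex.sin (Real.pi * w) - Real.pi‖ := by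
  have h3 : |w.im| ^ 4 ≤ |Real.sinh (Real.pi * w.im)| := by
    rw [Real.abs_sinh, abs_mul, abs_of_pos Real.pi_pos]
    exact pow_four_le_sinh_pi_mul h1
  have h4 := Complex.abs_sinh_le_norm_sin_pi_mul w
  have h5 : ‖(l * Complex.sin (Real.pi * w) : ℂ)‖ - ‖(Real.pi : ℂ)‖ ≤
      ‖l * Complex.sin (Real.pi * w) - Real.pi‖ := norm_sub_norm_le _ _
  rw [norm_mul, Complex.norm_real, Complex.norm_real, Real.norm_of_nonneg hl.le,
    Real.norm_of_nonneg Real.pi_pos.le] at h5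
  have h6 : w.im ^ 4 = |w.im| ^ 4 := by rw [← abs_pow, abs_of_nonneg (by positivity)]
  have h7 : |w.im| ≤ |w.im| ^ 4 := le_self_pow₀ h1 (by norm_num)
  rw [div_le_iff₀ hl] at h2
  rw [h6]
  nlinarith

theorem integrable_of_continuous_of_norm_le_div_sq {g : ℝ → ℂ} (hg : Continuous g) {C T : ℝ}
    (hT : 1 ≤ T) (h : ∀ t, T ≤ |t| → ‖g t‖ ≤ C / t ^ 2) : Integrable g := by
  obtain ⟨B, hB⟩ := (isCompact_Icc (a := -T) (b := T)).exists_bound_of_continuousOn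
    hg.continuousOn
  have hB0 : 0 ≤ B := (norm_nonneg _).trans (hB 0 ⟨by linarith, by linarith⟩)
  have hC0 : 0 ≤ C := by
    have h1 := (norm_nonneg _).trans (h T (le_abs_self T))
    have h2 : 0 < T ^ 2 := by positivity
    rw [le_div_iff₀ h2] at h1
    linarith
  refine (integrable_inv_one_add_sq.const_mul (B * (1 + T ^ 2) + 2 * C)).mono'
    hg.aestronglyMeasurable (Filter.Eventually.of_forall fun t => ?_)
  have h1 : 0 < 1 + t ^ 2 := by positivity
  rw [← div_eq_mul_inv, le_div_iff₀ h1]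
  rcases le_total T |t| with ht | ht
  · have h2 : 1 ≤ t ^ 2 := by
      rw [← sq_abs]
      nlinarith
    have h3 := h t ht
    rw [le_div_iff₀ (by positivity)] at h3
    nlinarith [norm_nonneg (g t), mul_nonneg hB0 (by positivity : 0 ≤ 1 + T ^ 2)]
  · have h2 := hB t (abs_le.1 ht)
    have h3 : t ^ 2 ≤ T ^ 2 := by
      rw [← sq_abs]
      nlinarith [abs_nonneg t]
    nlinarith [norm_nonneg (g t)]

/-- Shift of a vertical line of integration for a holomorphic function with quadratic decay in a
closed vertical strip. -/
theorem integral_vertical_line_eq {F : ℂ → ℂ} {a b C T : ℝ} (hab : a ≤ b) (hT : 1 ≤ T)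
    (hd : ∀ w : ℂ, a ≤ w.re → w.re ≤ b → DifferentiableAt ℂ F w)
    (hF : ∀ w : ℂ, a ≤ w.re → w.re ≤ b → T ≤ |w.im| → ‖F w‖ ≤ C / w.im ^ 2) :
    ∫ t : ℝ, F (a + t * Complex.I) = ∫ t : ℝ, F (b + t * Complex.I) := by
  have hline : ∀ σ, a ≤ σ → σ ≤ b → Integrable fun t : ℝ => F (σ + t * Complex.I) :=
    fun σ h1 h2 => by
      refine integrable_of_continuous_of_norm_le_div_sq (C := C) ?_ hT fun t ht => ?_
      · refine continuous_iff_continuousAt.2 fun t => ?_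
        have hc : Continuous fun t : ℝ => (σ : ℂ) + t * Complex.I := by fun_prop
        exact ContinuousAt.comp (f := fun t : ℝ => (σ : ℂ) + t * Complex.I) (g := F)
          (hd _ (by simpa using h1) (by simpa using h2)).continuousAt hc.continuousAt
      · simpa using hF (σ + t * Complex.I) (by simpa using h1) (by simpa using h2)
          (by simpa using ht)
  have hlim : ∀ σ, a ≤ σ → σ ≤ b → Filter.Tendsto
      (fun R : ℝ => ∫ t in (-R)..R, F (σ + t * Complex.I)) Filter.atTop
      (nhds (∫ t : ℝ, F (σ + t * Complex.I))) := fun σ h1 h2 =>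
    intervalIntegral_tendsto_integral (hline σ h1 h2) Filter.tendsto_neg_atTop_atBot
      Filter.tendsto_id
  have hhor : ∀ R, T ≤ |R| → ‖∫ x in a..b, F (x + R * Complex.I)‖ ≤ C / R ^ 2 * |b - a| :=
    fun R hR => by
      refine intervalIntegral.norm_integral_le_of_norm_le_const fun x hx => ?_
      rw [uIoc_of_le hab] at hx
      simpa using hF (x + R * Complex.I) (by simpa using hx.1.le) (by simpa using hx.2)
        (by simpa using hR)
  have hdiff : ∀ R, T ≤ R → ‖(∫ t in (-R)..R, F (a + t * Complex.I)) -
      ∫ t in (-R)..R, F (b + t * Complex.I)‖ ≤ 2 * (C / R ^ 2 * |b - a|) := fun R hR => by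
    have h := Complex.integral_boundary_rect_eq_zero_of_differentiableOn F
      (a + (-R : ℝ) * Complex.I) (b + R * Complex.I) (fun w hw => by
        have h1 := (Complex.mem_reProdIm.1 hw).1
        have e1 : (a + (-R : ℝ) * Complex.I : ℂ).re = a := by simp
        have e2 : (b + R * Complex.I : ℂ).re = b := by simp
        rw [e1, e2, uIcc_of_le hab] at h1
        exact (hd w h1.1 h1.2).differentiableWithinAt)
    have e1 : (a + (-R : ℝ) * Complex.I : ℂ).re = a := by simp
    have e2 : (b + R * Complex.I : ℂ).re = b := by simp
    have e3 : (a + (-R : ℝ) * Complex.I : ℂ).im = -R := by simp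
    have e4 : (b + R * Complex.I : ℂ).im = R := by simp
    rw [e1, e2, e3, e4] at h
    have h5 := hhor R (by rw [abs_of_nonneg (by linarith)]; exact hR)
    have h6 := hhor (-R) (by rw [abs_neg, abs_of_nonneg (by linarith)]; exact hR)
    rw [neg_sq] at h6
    simp only [smul_eq_mul] at h
    have key : (∫ t in (-R)..R, F (a + t * Complex.I)) - ∫ t in (-R)..R, F (b + t * Complex.I) =
        -Complex.I * ((∫ x in a..b, F (x + (-R : ℝ) * Complex.I)) -
          ∫ x in a..b, F (x + R * Complex.I)) := by
      linear_combination Complex.I * h + ((∫ t in (-R)..R, F (a + t * Complex.I)) -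
        ∫ t in (-R)..R, F (b + t * Complex.I)) * Complex.I_sq
    rw [key, norm_mul, norm_neg, Complex.norm_I, one_mul]
    exact (norm_sub_le _ _).trans (by linarith)
  have hz : Filter.Tendsto (fun R : ℝ => 2 * (C / R ^ 2 * |b - a|)) Filter.atTop (nhds 0) := by
    have h1 : Filter.Tendsto (fun R : ℝ => C / R ^ 2) Filter.atTop (nhds 0) :=
      tendsto_const_nhds.div_atTop (Filter.tendsto_pow_atTop two_ne_zero)
    simpa using (h1.mul_const |b - a|).const_mul 2
  have h0 := squeeze_zero_norm' ((Filter.eventually_ge_atTop T).mono hdiff) hz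
  exact sub_eq_zero.1 (tendsto_nhds_unique ((hlim a le_rfl hab).sub (hlim b hab le_rfl)) h0)

/-! ### The Stieltjes transform of a square-summable sequence -/

theorem lp_two_summable_mul_norm {ι : Type*} (f g : lp (fun _ : ι => ℂ) 2) :
    (Summable fun n => ‖f n‖ * ‖g n‖) ∧ ∑' n, ‖f n‖ * ‖g n‖ ≤ ‖f‖ * ‖g‖ := by
  obtain ⟨h1, h2⟩ := summable_and_tsum_sq_le_of_sq_eq_mul (r := fun n => ‖f n‖ * ‖g n‖)
    (f := fun n => ‖f n‖ ^ 2) (g := fun n => ‖g n‖ ^ 2) (fun n => by positivity)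
    (fun n => by positivity) (fun n => by positivity) (fun n => mul_pow _ _ _)
    (lp_two_summable_sq f) (lp_two_summable_sq g)
  refine ⟨h1, le_of_sq_le_sq ?_ (by positivity)⟩
  rwa [mul_pow, lp_two_norm_sq, lp_two_norm_sq]

/-- The transform `x ↦ ∑ a_n / (√n (x + log n))` of a square-summable sequence. -/
noncomputable def logStieltjes (f : DirichletH20) (x : ℝ) : ℂ :=
  ∑' n : IndexTwo, f n / ((√((n : ℕ) : ℝ) : ℝ) : ℂ) * ((1 / (x + Real.log (n : ℕ)) : ℝ) : ℂ)

/-- The derivative of `logStieltjes`. -/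
noncomputable def logStieltjesDeriv (f : DirichletH20) (x : ℝ) : ℂ :=
  ∑' n : IndexTwo, f n / ((√((n : ℕ) : ℝ) : ℝ) : ℂ) *
    ((-1 / (x + Real.log (n : ℕ)) ^ 2 : ℝ) : ℂ)

theorem norm_div_sqrt_div_log (f : DirichletH20) (n : IndexTwo) :
    ‖f n / ((√((n : ℕ) : ℝ) : ℝ) : ℂ)‖ * (1 / Real.log (n : ℕ)) =
      ‖f n‖ * ‖logPower 0 (by norm_num) n‖ := by
  rw [logPower_apply, norm_div, norm_div, Complex.norm_cpow_eq_rpow_re_of_pos n.log_pos]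
  simp only [zero_sub, Complex.neg_re, Complex.one_re, Real.rpow_neg_one]
  ring

theorem summable_norm_div_sqrt_div_log (f : DirichletH20) : Summable fun n : IndexTwo =>
    ‖f n / ((√((n : ℕ) : ℝ) : ℝ) : ℂ)‖ * (1 / Real.log (n : ℕ)) := by
  simp_rw [norm_div_sqrt_div_log]
  exact (lp_two_summable_mul_norm f _).1

theorem norm_logStieltjes_term_le (f : DirichletH20) (n : IndexTwo) {x : ℝ} (hx : 0 < x) :
    ‖f n / ((√((n : ℕ) : ℝ) : ℝ) : ℂ) * ((1 / (x + Real.log (n : ℕ)) : ℝ) : ℂ)‖ ≤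
      2 * (‖f n / ((√((n : ℕ) : ℝ) : ℝ) : ℂ)‖ * (1 / Real.log (n : ℕ))) := by
  have hl := n.log_pos
  have h1 : 1 / (x + Real.log (n : ℕ)) ≤ 1 / Real.log (n : ℕ) :=
    one_div_le_one_div_of_le hl (by linarith)
  have h2 : 0 ≤ 1 / (x + Real.log (n : ℕ)) := by positivity
  rw [norm_mul, Complex.norm_real, Real.norm_of_nonneg h2]
  have := norm_nonneg (f n / ((√((n : ℕ) : ℝ) : ℝ) : ℂ))
  nlinarith

theorem norm_logStieltjesDeriv_term_le (f : DirichletH20) (n : IndexTwo) {x : ℝ} (hx : 0 < x) :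
    ‖f n / ((√((n : ℕ) : ℝ) : ℝ) : ℂ) * ((-1 / (x + Real.log (n : ℕ)) ^ 2 : ℝ) : ℂ)‖ ≤
      2 * (‖f n / ((√((n : ℕ) : ℝ) : ℝ) : ℂ)‖ * (1 / Real.log (n : ℕ))) := by
  have hl := n.half_le_log
  have h1 : 1 / (x + Real.log (n : ℕ)) ^ 2 ≤ 2 * (1 / Real.log (n : ℕ)) := by
    rw [mul_one_div, div_le_div_iff₀ (by positivity) (by linarith)]
    nlinarith
  rw [norm_mul, Complex.norm_real, neg_div, norm_neg, Real.norm_of_nonneg (by positivity)]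
  have := norm_nonneg (f n / ((√((n : ℕ) : ℝ) : ℝ) : ℂ))
  nlinarith

/-- The series and its termwise derivative share the majorant `2 |a_n| / (√n log n)`, summable by
Cauchy–Schwarz against `logPower 0`. The factor `2` is needed for the derivative, where `1/(x + log
n)²` is reduced to a first power using `log n ≥ 1/2`. -/
theorem tameAmplitude_logStieltjes (f : DirichletH20) :
    TameAmplitude (logStieltjes f) (logStieltjesDeriv f)
      (∑' n : IndexTwo, 2 * (‖f n / ((√((n : ℕ) : ℝ) : ℝ) : ℂ)‖ * (1 / Real.log (n : ℕ)))) where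
  hasDerivAt x hx := by
    refine hasDerivAt_tsum_of_isPreconnected ((summable_norm_div_sqrt_div_log f).mul_left 2)
      isOpen_Ioi isPreconnected_Ioi (t := Ioi (0 : ℝ)) (fun n y hy => ?_)
      (fun n y hy => norm_logStieltjesDeriv_term_le f n hy) hx ?_ hx
    · exact ((tameAmplitude_inv_add n.log_pos).hasDerivAt y hy).const_mul _
    · exact Summable.of_norm_bounded ((summable_norm_div_sqrt_div_log f).mul_left 2)
        fun n => norm_logStieltjes_term_le f n hx
  continuousOn_deriv := by
    refine continuousOn_tsum (fun n => ?_) ((summable_norm_div_sqrt_div_log f).mul_left 2)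
      fun n x hx => norm_logStieltjesDeriv_term_le f n hx
    exact continuousOn_const.mul (tameAmplitude_inv_add n.log_pos).continuousOn_deriv
  norm_le x hx := tsum_of_norm_bounded ((summable_norm_div_sqrt_div_log f).mul_left 2).hasSum
    fun n => norm_logStieltjes_term_le f n hx
  norm_deriv_le x hx :=
    tsum_of_norm_bounded ((summable_norm_div_sqrt_div_log f).mul_left 2).hasSum
      fun n => norm_logStieltjesDeriv_term_le f n
        (lt_of_lt_of_le (Real.log_pos one_lt_two) hx)

/-- For an eigenvector the samples of the transform at `log m` are multiples of its own
coefficients; this closes the functional equation. -/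
theorem logStieltjes_log (f : DirichletH20) (m : IndexTwo) :
    logStieltjes f (Real.log (m : ℕ)) =
      ((√((m : ℕ) : ℝ) : ℝ) : ℂ) * multHilbertOperator f m := by
  have hm : ((√((m : ℕ) : ℝ) : ℝ) : ℂ) ≠ 0 := by
    exact_mod_cast (Real.sqrt_pos.2 m.pos).ne'
  rw [← ((hasSum_multHilbertOperator f m).mul_left _).tsum_eq, logStieltjes]
  refine tsum_congr fun n => ?_
  rw [multHilbertMatrix_apply, add_comm (Real.log (m : ℕ))]
  push_cast
  field_simp

/-- The series `∑ a_n (log n)^{w-1} / √n`. -/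
noncomputable def logSeries (f : DirichletH20) (w : ℂ) : ℂ :=
  ∑' n : IndexTwo, f n * (((Real.log (n : ℕ) : ℝ) : ℂ) ^ (w - 1) / ((√((n : ℕ) : ℝ) : ℝ) : ℂ))

/-- Cauchy–Schwarz against `logPower w` allows only a square-root singularity at `Re w = 1/2`,
weaker than any pole. -/
theorem norm_logSeries_le (f : DirichletH20) {w : ℂ} (hw : -(1 / 2) ≤ w.re ∧ w.re < 1 / 2) :
    ‖logSeries f w‖ ≤ ‖f‖ * √(6 / (1 / 2 - w.re)) := by
  obtain ⟨h1, h2⟩ := lp_two_summable_mul_norm f (logPower w hw)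
  refine (tsum_of_norm_bounded h1.hasSum fun n => ?_).trans (h2.trans ?_)
  · rw [norm_mul, logPower_apply]
  · gcongr
    exact Real.le_sqrt_of_sq_le (norm_logPower_sq_le hw)

/-- Each term has an explicit Mellin transform. Termwise integration needs `∑ |a_n| (log n)^{Re w -
1}/√n` to converge, which square-summability ensures for `Re w < 1/2`. -/
theorem hasMellin_logStieltjes (f : DirichletH20) {w : ℂ} (hw0 : 0 < w.re) (hw : w.re < 1 / 2) :
    MellinConvergent (logStieltjes f) w ∧
      mellin (logStieltjes f) w = Real.pi / Complex.sin (Real.pi * w) * logSeries f w := by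
  have hw' : -(1 / 2) ≤ w.re ∧ w.re < 1 / 2 := ⟨by linarith, hw⟩
  have hw1 : w.re < 1 := by linarith
  set c : IndexTwo → ℂ := fun n => f n / ((√((n : ℕ) : ℝ) : ℝ) : ℂ) with hc
  set F : IndexTwo → ℝ → ℂ := fun n x =>
    c n * ((x : ℂ) ^ (w - 1) • ((1 / (x + Real.log (n : ℕ)) : ℝ) : ℂ)) with hF
  have hI : ∀ n, IntegrableOn (F n) (Ioi 0) := fun n =>
    (mellinConvergent_inv_add n.log_pos hw0 hw1).const_mul (c n)
  have hval : ∀ n, ∫ x in Ioi (0 : ℝ), F n x = Real.pi / Complex.sin (Real.pi * w) *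
      (f n * (((Real.log (n : ℕ) : ℝ) : ℂ) ^ (w - 1) / ((√((n : ℕ) : ℝ) : ℝ) : ℂ))) := fun n => by
    have := mellin_inv_add n.log_pos hw0 hw1
    rw [mellin] at this
    simp only [hF]
    rw [integral_const_mul, this]
    simp only [hc]
    ring
  have hs : Summable fun n => ∫ x in Ioi (0 : ℝ), ‖F n x‖ := by
    have h1 := (lp_two_summable_mul_norm f (logPower w hw')).1.mul_left
      (Real.pi / Real.sin (Real.pi * w.re))
    refine h1.congr fun n => ?_
    simp only [hF, norm_mul]
    rw [integral_const_mul, integral_norm_cpow_smul_inv_add n.log_pos hw0 hw1, logPower_apply,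
      norm_div, Complex.norm_cpow_eq_rpow_re_of_pos n.log_pos, Complex.sub_re, Complex.one_re]
    simp only [hc, norm_div]
    ring
  have hsum : ∀ x : ℝ, ∑' n, F n x = (x : ℂ) ^ (w - 1) • logStieltjes f x := fun x => by
    rw [logStieltjes, smul_eq_mul, ← tsum_mul_left]
    refine tsum_congr fun n => ?_
    simp only [hF, hc, smul_eq_mul]
    ring
  have h1 := integrable_tsum_of_summable_integral_norm hI hs
  have h2 := hasSum_integral_of_summable_integral_norm hI hs
  simp_rw [hsum] at h1 h2
  simp_rw [hval] at h2
  refine ⟨h1, ?_⟩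
  rw [mellin, ← h2.tsum_eq, logSeries, tsum_mul_left]

/-! ### Eigenvectors: functional equation, continuation and decay -/

/-- The functional equation for the Mellin transform attached to an eigenvector. -/
theorem mellin_logStieltjes_eq {f : DirichletH20} {l : ℝ}
    (hf : multHilbertOperator f = (l : ℂ) • f) {w : ℂ} (hw0 : 0 < w.re) (hw : w.re < 1 / 2) :
    (l * Complex.sin (Real.pi * w) - Real.pi) * mellin (logStieltjes f) w =
      Real.pi * mellinDiscrepancy (logStieltjes f) (logStieltjesDeriv f) w := by
  obtain ⟨h1, h2⟩ := hasMellin_logStieltjes f hw0 hw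
  have h3 := ((tameAmplitude_logStieltjes f).hasSum_mellin h1).tsum_eq
  -- The eigenvalue equation turns the sum from Euler summation back into `logSeries`, which also
  -- appears in the Mellin transform; eliminating it gives the functional equation.
  have h4 : ∑' n : IndexTwo, ((Real.log (n : ℕ) : ℝ) : ℂ) ^ (w - 1) *
      logStieltjes f (Real.log (n : ℕ)) / ((n : ℕ) : ℂ) = l * logSeries f w := by
    rw [logSeries, ← tsum_mul_left]
    refine tsum_congr fun n => ?_
    have hm : ((√((n : ℕ) : ℝ) : ℝ) : ℂ) ≠ 0 := by
      exact_mod_cast (Real.sqrt_pos.2 n.pos).ne'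
    have e : (((n : ℕ) : ℝ) : ℂ) = ((√((n : ℕ) : ℝ) : ℝ) : ℂ) * ((√((n : ℕ) : ℝ) : ℝ) : ℂ) := by
      rw [← Complex.ofReal_mul, Real.mul_self_sqrt n.pos.le]
    rw [Complex.ofReal_natCast] at e
    have h5 : multHilbertOperator f n = l * f n := by
      rw [hf]
      rfl
    rw [logStieltjes_log, h5]
    conv_lhs => rw [e]
    field_simp
  have hsin : Complex.sin (Real.pi * w) ≠ 0 := by
    intro h0
    obtain ⟨k, hk⟩ := Complex.sin_eq_zero_iff.1 h0
    have hk' : w = k := by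
      have : (Real.pi : ℂ) ≠ 0 := by exact_mod_cast Real.pi_pos.ne'
      rw [mul_comm] at hk
      exact mul_right_cancel₀ this hk
    rw [hk', Complex.intCast_re] at hw0 hw
    have a : 0 < k := by exact_mod_cast hw0
    have b : k < 1 := by exact_mod_cast (by linarith : (k : ℝ) < 1)
    omega
  have h6 : Complex.sin (Real.pi * w) * mellin (logStieltjes f) w =
      Real.pi * logSeries f w := by
    rw [h2]
    field_simp
  rw [h4] at h3
  linear_combination l * h6 + Real.pi * h3

/-- A meromorphic function that is `o(1/ε)` along the horizontal approach `x - ε` has no pole. -/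
theorem meromorphicOrderAt_nonneg_of_tendsto {K : ℂ → ℂ} {x : ℂ} (hK : MeromorphicAt K x)
    (h : Filter.Tendsto (fun ε : ℝ => ε * ‖K (x - ε)‖) (nhdsWithin 0 (Ioi 0)) (nhds 0)) :
    0 ≤ meromorphicOrderAt K x := by
  by_contra hneg
  rw [not_le] at hneg
  obtain ⟨n, hn⟩ := WithTop.ne_top_iff_exists.1 hneg.ne_top
  obtain ⟨g, hg, hg0, he⟩ := (meromorphicOrderAt_eq_int_iff hK).1 hn.symm
  have hn1 : n < 0 := by
    rw [← hn] at hneg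
    exact_mod_cast hneg
  have hpc : Filter.Tendsto (fun ε : ℝ => x - ε) (nhdsWithin 0 (Ioi 0)) (nhds x) := by
    have : Continuous fun ε : ℝ => x - (ε : ℂ) := by fun_prop
    have h0 := this.tendsto 0
    simp only [Complex.ofReal_zero, sub_zero] at h0
    exact h0.mono_left nhdsWithin_le_nhds
  have hp : Filter.Tendsto (fun ε : ℝ => x - ε) (nhdsWithin 0 (Ioi 0)) (nhdsWithin x {x}ᶜ) := by
    refine tendsto_nhdsWithin_iff.2 ⟨hpc, ?_⟩
    filter_upwards [self_mem_nhdsWithin] with ε hε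
    have hε : (0 : ℝ) < ε := hε
    simpa using hε.ne'
  have hgt : Filter.Tendsto (fun ε : ℝ => ‖g (x - ε)‖) (nhdsWithin 0 (Ioi 0)) (nhds ‖g x‖) :=
    (hg.continuousAt.tendsto.comp hpc).norm
  -- For order `n ≤ -1` one has `ε · ε^n ≥ 1` on `(0, 1)`, so the leading coefficient is dominated
  -- by a quantity tending to `0`.
  have hle : ‖g x‖ ≤ 0 := by
    refine le_of_tendsto_of_tendsto hgt h ?_
    filter_upwards [hp.eventually he, Ioo_mem_nhdsGT (zero_lt_one (α := ℝ))] with ε h1 h2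
    rw [h1, norm_smul, sub_sub_cancel_left, norm_zpow, norm_neg, Complex.norm_real,
      Real.norm_of_nonneg h2.1.le, ← mul_assoc]
    refine le_mul_of_one_le_left (norm_nonneg _) ?_
    have h3 : ε * ε ^ n = ε ^ (n + 1) := by
      rw [zpow_add_one₀ h2.1.ne', mul_comm]
    rw [h3]
    have h4 : ε ^ (0 : ℤ) ≤ ε ^ (n + 1) :=
      zpow_le_zpow_right_of_le_one₀ h2.1 h2.2.le (by omega)
    simpa using h4
  exact hg0 (norm_le_zero_iff.1 hle)

/-- The Mellin transform attached to an eigenvector continues holomorphically to the strip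
`0 < Re w < 5/2`. -/
theorem exists_mellin_continuation {f : DirichletH20} {l : ℝ} (hl : 0 < l) (hl' : l ≤ Real.pi)
    (hf : multHilbertOperator f = (l : ℂ) • f) :
    ∃ G : ℂ → ℂ, (∀ w : ℂ, 0 < w.re → w.re < 5 / 2 → DifferentiableAt ℂ G w) ∧
      ∀ w : ℂ, 0 < w.re → w.re < 5 / 2 → l * Complex.sin (Real.pi * w) - Real.pi ≠ 0 →
        G w = Real.pi * mellinDiscrepancy (logStieltjes f) (logStieltjesDeriv f) w /
          (l * Complex.sin (Real.pi * w) - Real.pi) := by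
  set E := mellinDiscrepancy (logStieltjes f) (logStieltjesDeriv f) with hE
  set D : ℂ → ℂ := fun w => l * Complex.sin (Real.pi * w) - Real.pi with hD
  set K : ℂ → ℂ := fun w => Real.pi * E w / D w with hK
  set U : Set ℂ := {w | 0 < w.re ∧ w.re < 5 / 2} with hU
  have hUo : IsOpen U := (isOpen_lt continuous_const Complex.continuous_re).inter
    (isOpen_lt Complex.continuous_re continuous_const)
  have hEa : ∀ w ∈ U, AnalyticAt ℂ E w := fun w hw =>
    DifferentiableOn.analyticAt (s := U) (fun z hz =>
      ((tameAmplitude_logStieltjes f).differentiableAt_mellinDiscrepancy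
        hz.1).differentiableWithinAt) (hUo.mem_nhds hw)
  have hDd : Differentiable ℂ D := by
    refine Differentiable.sub_const ?_ _
    exact (Complex.differentiable_sin.comp (differentiable_id.const_mul _)).const_mul _
  have hDa : ∀ w, AnalyticAt ℂ D w := fun w => hDd.analyticAt w
  have hna : ∀ w ∈ U, AnalyticAt ℂ (fun w => Real.pi * E w) w := fun w hw =>
    analyticAt_const.mul (hEa w hw)
  have hKm : MeromorphicOn K U := fun w hw => (hna w hw).meromorphicAt.div (hDa w).meromorphicAt
  have hKan : ∀ w ∈ U, D w ≠ 0 → AnalyticAt ℂ K w := fun w hw h => (hna w hw).div (hDa w) h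
  have hord : ∀ w ∈ U, 0 ≤ meromorphicOrderAt K w := fun w hw => by
    by_cases h : D w = 0
    -- The zero may be double (`l = π`, `w = 1/2`), so the order of the denominator does not help.
    -- Approaching from the left, where `K` is the Mellin transform itself, Cauchy–Schwarz gives `ε
    -- ‖K‖ = O(√ε)`.
    · have hre := re_eq_half_of_mul_sin_eq hl hl' hw.1 hw.2 h
      refine meromorphicOrderAt_nonneg_of_tendsto (hKm w hw) ?_
      set S : ℝ → ℝ := fun ε => ‖Real.pi / Complex.sin (Real.pi * (w - ε))‖ with hS
      have hbd : ∀ᶠ ε : ℝ in nhdsWithin (0 : ℝ) (Ioi 0),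
          ‖(ε * ‖K (w - ε)‖ : ℝ)‖ ≤ S ε * (‖f‖ * √(6 * ε)) := by
        filter_upwards [Ioo_mem_nhdsGT (by norm_num : (0 : ℝ) < 1 / 2)] with ε hε
        have hr : (w - ε).re = 1 / 2 - ε := by simp [hre]
        have h0 : 0 < (w - ε).re := by rw [hr]; linarith [hε.2]
        have h1 : (w - ε).re < 1 / 2 := by rw [hr]; linarith [hε.1]
        have hDne : D (w - ε) ≠ 0 := fun h2 => by
          have := re_eq_half_of_mul_sin_eq hl hl' h0 (by linarith) h2
          linarith
        have hKN : K (w - ε) = mellin (logStieltjes f) (w - ε) := by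
          rw [hK]
          simp only
          rw [div_eq_iff hDne, ← mellin_logStieltjes_eq hf h0 h1, mul_comm]
        have hlog := norm_logSeries_le f (w := w - ε) ⟨by linarith, h1⟩
        rw [hr, sub_sub_cancel] at hlog
        rw [Real.norm_of_nonneg (mul_nonneg hε.1.le (norm_nonneg _)), hKN,
          (hasMellin_logStieltjes f h0 h1).2, norm_mul]
        have hsq : ε * √(6 / ε) = √(6 * ε) := by
          rw [show (6 : ℝ) * ε = ε ^ 2 * (6 / ε) by field_simp [hε.1.ne'],
            Real.sqrt_mul (by positivity), Real.sqrt_sq hε.1.le]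
        calc ε * (S ε * ‖logSeries f (w - ε)‖) ≤ ε * (S ε * (‖f‖ * √(6 / ε))) := by
              have := hε.1.le
              gcongr
          _ = S ε * (‖f‖ * (ε * √(6 / ε))) := by ring
          _ = _ := by rw [hsq]
      refine squeeze_zero_norm' hbd ?_
      -- At a zero of `D` the sine equals `π / l`, so the factor `π / sin` stays bounded.
      have hsin : Complex.sin (Real.pi * (w - ((0 : ℝ) : ℂ))) ≠ 0 := by
        intro h0
        rw [Complex.ofReal_zero, sub_zero] at h0
        simp only [hD, h0, mul_zero, zero_sub, neg_eq_zero] at h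
        exact Real.pi_pos.ne' (by exact_mod_cast h)
      have hSc : ContinuousAt S 0 := by
        refine ContinuousAt.norm (continuousAt_const.div ?_ hsin)
        exact Continuous.continuousAt (by fun_prop)
      have hqc : ContinuousAt (fun ε : ℝ => ‖f‖ * √(6 * ε)) 0 :=
        Continuous.continuousAt (by fun_prop)
      have := hSc.tendsto.mul hqc.tendsto
      simp only [mul_zero, Real.sqrt_zero] at this
      exact this.mono_left nhdsWithin_le_nhds
    · exact (hKan w hw h).meromorphicOrderAt_nonneg
  -- At a zero of `D` the quotient `K` has the default value `0`; the normal form fills in the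
  -- removable singularities.
  refine ⟨toMeromorphicNFOn K U, fun w h0 h1 => ?_, fun w h0 h1 hne => ?_⟩
  · have hw : w ∈ U := ⟨h0, h1⟩
    have hNF := meromorphicNFOn_toMeromorphicNFOn K U hw
    refine (hNF.meromorphicOrderAt_nonneg_iff_analyticAt.1 ?_).differentiableAt
    rw [meromorphicOrderAt_toMeromorphicNFOn hKm hw]
    exact hord w hw
  · have hw : w ∈ U := ⟨h0, h1⟩
    rw [toMeromorphicNFOn_eq_toMeromorphicNFAt hKm hw,
      toMeromorphicNFAt_eq_self.2 (hKan w hw hne).meromorphicNFAt]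

/-- The transform attached to an eigenvector decays quadratically. -/
theorem exists_norm_logStieltjes_le {f : DirichletH20} {l : ℝ} (hl : 0 < l) (hl' : l ≤ Real.pi)
    (hf : multHilbertOperator f = (l : ℂ) • f) :
    ∃ C, ∀ y : ℝ, 0 < y → ‖logStieltjes f y‖ ≤ C / y ^ 2 := by
  obtain ⟨G, hGd, hGK⟩ := exists_mellin_continuation hl hl' hf
  have htame := tameAmplitude_logStieltjes f
  set A := ∑' n : IndexTwo, 2 * (‖f n / ((√((n : ℕ) : ℝ) : ℝ) : ℂ)‖ * (1 / Real.log (n : ℕ)))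
    with hA
  have hA0 : 0 ≤ A := htame.nonneg
  set T : ℝ := 1 + 2 * Real.pi / l with hT
  have hT0 : 0 < 2 * Real.pi / l := by have := Real.pi_pos; positivity
  have hT1 : 1 ≤ T := by linarith
  have hGN : ∀ w : ℂ, 0 < w.re → w.re < 1 / 2 → G w = mellin (logStieltjes f) w :=
    fun w h0 h1 => by
      have hne : l * Complex.sin (Real.pi * w) - Real.pi ≠ 0 := fun h => by
        have := re_eq_half_of_mul_sin_eq hl hl' h0 (by linarith) h
        linarith
      rw [hGK w h0 (by linarith) hne, div_eq_iff hne, ← mellin_logStieltjes_eq hf h0 h1, mul_comm]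
  -- Here `1 + ‖w‖ ≤ 3 + |w.im| ≤ 4 |w.im|`, and `160 = 20 · 4 · 2`. The quotient decays like
  -- `|w.im|⁻³`, of which only the square is kept.
  have hGb : ∀ w : ℂ, 1 / 4 ≤ w.re → w.re ≤ 2 → T ≤ |w.im| →
      ‖G w‖ ≤ 160 * Real.pi * A / l / w.im ^ 2 := fun w h0 h1 h2 => by
    have ht1 : 1 ≤ |w.im| := by linarith
    have ht0 : 0 < |w.im| := by linarith
    have hden := norm_mul_sin_sub_pi_ge hl ht1 (by linarith)
    have h4 : w.im ^ 4 = |w.im| ^ 4 := by rw [← abs_pow, abs_of_nonneg (by positivity)]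
    rw [h4] at hden
    have hpos : 0 < l / 2 * |w.im| ^ 4 := by positivity
    have hne : l * Complex.sin (Real.pi * w) - Real.pi ≠ 0 :=
      norm_pos_iff.1 (hpos.trans_le hden)
    have hE := htame.norm_mellinDiscrepancy_le h0 h1
    have hw : ‖w‖ ≤ 2 + |w.im| := by
      refine (Complex.norm_le_abs_re_add_abs_im w).trans (add_le_add_left ?_ _)
      rw [abs_of_nonneg (by linarith)]
      exact h1
    rw [hGK w (by linarith) (by linarith) hne, norm_div, norm_mul, Complex.norm_real,
      Real.norm_of_nonneg Real.pi_pos.le]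
    calc Real.pi * ‖mellinDiscrepancy (logStieltjes f) (logStieltjesDeriv f) w‖ /
          ‖l * Complex.sin (Real.pi * w) - Real.pi‖
        ≤ Real.pi * (20 * A * (4 * |w.im|)) / (l / 2 * |w.im| ^ 4) := by
          have := Real.pi_pos
          gcongr
          refine hE.trans ?_
          gcongr
          linarith
      _ = 160 * Real.pi * A / l / |w.im| ^ 2 / |w.im| := by
          field_simp
          ring
      _ ≤ 160 * Real.pi * A / l / |w.im| ^ 2 := by
          have := Real.pi_pos
          exact div_le_self (by positivity) ht1
      _ = _ := by rw [sq_abs]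
  have hcont : ∀ σ : ℝ, 1 / 4 ≤ σ → σ ≤ 2 → Continuous fun t : ℝ => G (σ + t * Complex.I) :=
    fun σ h0 h1 => by
      refine continuous_iff_continuousAt.2 fun t => ?_
      have hc : Continuous fun t : ℝ => (σ : ℂ) + t * Complex.I := by fun_prop
      have hre : ((σ : ℂ) + t * Complex.I).re = σ := by simp
      exact ContinuousAt.comp (f := fun t : ℝ => (σ : ℂ) + t * Complex.I) (g := G)
        (hGd _ (by rw [hre]; linarith) (by rw [hre]; linarith)).continuousAt hc.continuousAt
  have hint : ∀ σ : ℝ, 1 / 4 ≤ σ → σ ≤ 2 → Integrable fun t : ℝ => G (σ + t * Complex.I) :=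
    fun σ h0 h1 => by
      refine integrable_of_continuous_of_norm_le_div_sq (hcont σ h0 h1)
        (C := 160 * Real.pi * A / l) hT1 fun t ht => ?_
      simpa using hGb (σ + t * Complex.I) (by simpa using h0) (by simpa using h1)
        (by simpa using ht)
  have hNline : ∀ t : ℝ, mellin (logStieltjes f) (((1 / 4 : ℝ) : ℂ) + t * Complex.I) =
      G (((1 / 4 : ℝ) : ℂ) + t * Complex.I) := fun t => by
    have hre : (((1 / 4 : ℝ) : ℂ) + t * Complex.I).re = 1 / 4 := by simp
    exact (hGN _ (by rw [hre]; norm_num) (by rw [hre]; norm_num)).symm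
  -- Mellin inversion on `Re w = 1/4`, shifted to `Re w = 2` where `|y^{-w}| = y^{-2}`, leaves the
  -- `L¹` norm of `G` on the new line as the constant.
  refine ⟨1 / (2 * Real.pi) * ∫ t : ℝ, ‖G ((2 : ℝ) + t * Complex.I)‖, fun y hy => ?_⟩
  have hy0 : (y : ℂ) ≠ 0 := by exact_mod_cast hy.ne'
  have hinv := mellinInv_mellin_eq (1 / 4) (logStieltjes f) hy
    (hasMellin_logStieltjes f (by simp) (by norm_num [Complex.ofReal_re])).1
    (by
      refine (hint (1 / 4) le_rfl (by norm_num)).congr (Filter.Eventually.of_forall fun t => ?_)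
      exact (hNline t).symm)
    (htame.hasDerivAt y hy).continuousAt
  set F : ℂ → ℂ := fun w => (y : ℂ) ^ (-w) * G w with hF
  have hshift : ∫ t : ℝ, F (((1 / 4 : ℝ) : ℂ) + t * Complex.I) =
      ∫ t : ℝ, F (((2 : ℝ) : ℂ) + t * Complex.I) := by
    refine integral_vertical_line_eq (a := 1 / 4) (b := 2) (T := T)
      (C := (y ^ (-(1 / 4) : ℝ) + y ^ (-2 : ℝ)) * (160 * Real.pi * A / l)) (by norm_num) hT1
      (fun w h0 h1 => ?_) fun w h0 h1 h2 => ?_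
    · refine DifferentiableAt.mul ?_ (hGd w (by linarith) (by linarith))
      exact (differentiableAt_id.neg).const_cpow (Or.inl hy0)
    · rw [hF]
      simp only
      rw [norm_mul, Complex.norm_cpow_eq_rpow_re_of_pos hy, Complex.neg_re, mul_div_assoc]
      refine mul_le_mul ?_ (hGb w h0 h1 h2) (norm_nonneg _) (by positivity)
      -- On the strip `y^{-Re w}` is largest at the left edge if `y ≥ 1` and at the right edge if `y
      -- ≤ 1`; the sum of both values covers the two cases.
      rcases le_total 1 y with h | h
      · have := Real.rpow_le_rpow_of_exponent_le h (neg_le_neg h0)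
        have := Real.rpow_nonneg hy.le (-2)
        linarith
      · have := Real.rpow_le_rpow_of_exponent_ge hy h (neg_le_neg h1)
        have := Real.rpow_nonneg hy.le (-(1 / 4))
        linarith
  have hval : logStieltjes f y =
      (1 / (2 * Real.pi) : ℝ) • ∫ t : ℝ, F (((2 : ℝ) : ℂ) + t * Complex.I) := by
    rw [← hinv, ← hshift, mellinInv]
    congr 1
    refine integral_congr_ae (Filter.Eventually.of_forall fun t => ?_)
    simp only [hF, hNline, smul_eq_mul]
  rw [hval, norm_smul, Real.norm_of_nonneg (by have := Real.pi_pos; positivity), mul_div_assoc]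
  refine mul_le_mul_of_nonneg_left ?_ (by have := Real.pi_pos; positivity)
  refine (norm_integral_le_integral_norm _).trans (le_of_eq ?_)
  rw [← integral_div]
  refine integral_congr_ae (Filter.Eventually.of_forall fun t => ?_)
  simp only [hF]
  rw [norm_mul, Complex.norm_cpow_eq_rpow_re_of_pos hy]
  have hre : (-(((2 : ℝ) : ℂ) + t * Complex.I)).re = -2 := by simp
  rw [hre, Real.rpow_neg hy.le, Real.rpow_two, div_eq_inv_mul]

/-- The operator has no eigenvalue in `(0, π]`. -/
theorem eq_zero_of_multHilbertOperator_eq_smul {f : DirichletH20} {l : ℝ} (hl : 0 < l)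
    (hl' : l ≤ Real.pi) (hf : multHilbertOperator f = (l : ℂ) • f) : f = 0 := by
  obtain ⟨C, hC⟩ := exists_norm_logStieltjes_le hl hl' hf
  have hHf : ∀ n, multHilbertOperator f n = l * f n := fun n => by
    rw [hf]
    rfl
  have hsq : ∀ n : IndexTwo, ((√((n : ℕ) : ℝ) : ℝ) : ℂ) ≠ 0 := fun n => by
    exact_mod_cast (Real.sqrt_pos.2 n.pos).ne'
  -- The decay at `y = log n` reads `l √n |a_n| ≤ C / (log n)²`, so one factor `log n` can be spent
  -- and the sequence stays in `ℓ²`.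
  have hfn : ∀ n : IndexTwo, ‖((Real.log (n : ℕ) : ℝ) : ℂ) * f n‖ ≤
      C / l * ‖logPower 0 (by norm_num) n‖ := fun n => by
    have h1 := hC _ n.log_pos
    have hlog := n.log_pos
    have hs := Real.sqrt_pos.2 n.pos
    rw [logStieltjes_log, hHf, norm_mul, norm_mul, Complex.norm_real, Complex.norm_real,
      Real.norm_of_nonneg hs.le, Real.norm_of_nonneg hl.le, le_div_iff₀ (by positivity)] at h1
    rw [logPower_apply, norm_div, Complex.norm_cpow_eq_rpow_re_of_pos hlog, norm_mul,
      Complex.norm_real, Complex.norm_real, Real.norm_of_nonneg hs.le,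
      Real.norm_of_nonneg hlog.le]
    simp only [zero_sub, Complex.neg_re, Complex.one_re, Real.rpow_neg_one]
    have e : C / l * ((Real.log (n : ℕ))⁻¹ / √((n : ℕ) : ℝ)) =
        C / (l * Real.log (n : ℕ) * √((n : ℕ) : ℝ)) := by field_simp
    refine le_of_le_of_eq ((le_div_iff₀ (by positivity)).2 ?_) e.symm
    refine le_of_eq_of_le ?_ h1
    ring
  let g : DirichletH20 := ⟨fun n => ((Real.log (n : ℕ) : ℝ) : ℂ) * f n,
    memℓp_two_of_summable_sq (by
      refine Summable.of_nonneg_of_le (fun n => sq_nonneg _) (fun n => ?_)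
        ((lp_two_summable_sq (logPower 0 (by norm_num))).mul_left ((C / l) ^ 2))
      rw [← mul_pow]
      exact pow_le_pow_left₀ (norm_nonneg _) (hfn n) 2)⟩
  have hg : ∀ n, g n = ((Real.log (n : ℕ) : ℝ) : ℂ) * f n := fun n => rfl
  -- the terms `a_n / √n` are absolutely summable
  have hcs : Summable fun n : IndexTwo => ‖f n / ((√((n : ℕ) : ℝ) : ℝ) : ℂ)‖ := by
    refine (summable_norm_div_sqrt_div_log g).congr fun n => ?_
    have hlog := n.log_pos
    rw [hg, norm_div, norm_div, norm_mul, Complex.norm_real, Real.norm_of_nonneg hlog.le]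
    field_simp
  set c : ℂ := ∑' n : IndexTwo, f n / ((√((n : ℕ) : ℝ) : ℝ) : ℂ) with hc
  -- By dominated convergence `y N(y)` tends to `∑ a_n / √n`, while quadratic decay makes it
  -- `O(1/y)`.
  have hc0 : c = 0 := by
    have ht : Filter.Tendsto (fun y : ℝ => (y : ℂ) * logStieltjes f y) Filter.atTop (nhds c) := by
      have e : ∀ y : ℝ, (y : ℂ) * logStieltjes f y = ∑' n : IndexTwo,
          f n / ((√((n : ℕ) : ℝ) : ℝ) : ℂ) * ((y / (y + Real.log (n : ℕ)) : ℝ) : ℂ) := fun y => by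
        rw [logStieltjes, ← tsum_mul_left]
        refine tsum_congr fun n => ?_
        push_cast
        ring
      simp_rw [e]
      refine tendsto_tsum_of_dominated_convergence hcs (fun n => ?_) ?_
      · have h1 : Filter.Tendsto (fun y : ℝ => y / (y + Real.log (n : ℕ))) Filter.atTop
            (nhds 1) := by
          have h2 : Filter.Tendsto (fun y : ℝ => 1 - Real.log (n : ℕ) / (y + Real.log (n : ℕ)))
              Filter.atTop (nhds (1 - 0)) :=
            tendsto_const_nhds.sub (tendsto_const_nhds.div_atTop
              (Filter.tendsto_atTop_add_const_right _ _ Filter.tendsto_id))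
          rw [sub_zero] at h2
          refine h2.congr' ?_
          filter_upwards [Filter.eventually_gt_atTop 0] with y hy
          have := n.log_pos
          field_simp
          ring
        have h3 := ((Complex.continuous_ofReal.tendsto 1).comp h1).const_mul
          (f n / ((√((n : ℕ) : ℝ) : ℝ) : ℂ))
        simpa using h3
      · filter_upwards [Filter.eventually_gt_atTop 0] with y hy n
        have hlog := n.log_pos
        rw [norm_mul, Complex.norm_real, Real.norm_of_nonneg (by positivity)]
        refine mul_le_of_le_one_right (norm_nonneg _) ?_
        rw [div_le_one (by positivity)]
        linarith
    have hz : Filter.Tendsto (fun y : ℝ => (y : ℂ) * logStieltjes f y) Filter.atTop (nhds 0) := by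
      refine squeeze_zero_norm' (a := fun y => C / y) ?_
        (tendsto_const_nhds.div_atTop Filter.tendsto_id)
      filter_upwards [Filter.eventually_gt_atTop 0] with y hy
      rw [norm_mul, Complex.norm_real, Real.norm_of_nonneg hy.le]
      calc y * ‖logStieltjes f y‖ ≤ y * (C / y ^ 2) :=
            mul_le_mul_of_nonneg_left (hC y hy) hy.le
        _ = C / y := by field_simp
    exact tendsto_nhds_unique ht hz
  -- The factor `log n + log m` cancels the logarithm in the matrix, so `(H g)_m + (log m)(H f)_m`
  -- is the rank-one expression `c / √m`, which vanishes.
  have hHg : multHilbertOperator g = (-l : ℂ) • g := by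
    ext m
    have h1 := (hasSum_multHilbertOperator g m).add
      ((hasSum_multHilbertOperator f m).mul_left ((Real.log (m : ℕ) : ℝ) : ℂ))
    have h2 : HasSum (fun n : IndexTwo => (1 / ((√((m : ℕ) : ℝ) : ℝ) : ℂ)) *
        (f n / ((√((n : ℕ) : ℝ) : ℝ) : ℂ))) ((1 / ((√((m : ℕ) : ℝ) : ℝ) : ℂ)) * c) :=
      (Summable.of_norm hcs).hasSum.mul_left _
    have h3 := h1.unique (h2.congr_fun fun n => by
      have hL : ((Real.log (n : ℕ) : ℝ) : ℂ) + ((Real.log (m : ℕ) : ℝ) : ℂ) ≠ 0 := by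
        have := m.log_pos
        have := n.log_pos
        exact_mod_cast (by positivity : Real.log (n : ℕ) + Real.log (m : ℕ) ≠ 0)
      rw [hg, multHilbertMatrix_apply]
      have := hsq m
      have := hsq n
      push_cast
      push_cast at hL
      field_simp)
    rw [hc0, mul_zero, hHf] at h3
    have h4 : ((-l : ℂ) • g) m = -l * (((Real.log (m : ℕ) : ℝ) : ℂ) * f m) := rfl
    rw [h4]
    linear_combination h3
  -- A nonzero `g` would be an eigenvector with the negative eigenvalue `-l`, against strict
  -- positivity.
  have hg0 : g = 0 := by
    by_contra hne
    have h1 := inner_multHilbertOperator_pos hne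
    rw [hHg, inner_smul_left, inner_self_eq_norm_sq_to_K] at h1
    have h2 : ((starRingEnd ℂ) (-l : ℂ) * ((‖g‖ : ℝ) : ℂ) ^ 2).re = -(l * ‖g‖ ^ 2) := by
      rw [← Complex.ofReal_neg, Complex.conj_ofReal, ← Complex.ofReal_pow, ← Complex.ofReal_mul,
        Complex.ofReal_re]
      ring
    have h3 := h1.trans_eq h2
    nlinarith [sq_nonneg ‖g‖]
  ext n
  have h1 : ((Real.log (n : ℕ) : ℝ) : ℂ) * f n = 0 := by
    rw [← hg, hg0]
    rfl
  have h2 : ((Real.log (n : ℕ) : ℝ) : ℂ) ≠ 0 := by exact_mod_cast n.log_pos.ne'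
  exact (mul_eq_zero.1 h1).resolve_left h2

/-! ### The spectrum and the conclusion -/

theorem norm_le_norm_multHilbertOperator {z : ℂ} (hz : z ∈ spectrum ℂ multHilbertOperator) :
    ‖z‖ ≤ ‖multHilbertOperator‖ :=
  (spectrum.norm_le_norm_mul_of_mem hz).trans
    (mul_le_of_le_one_right (norm_nonneg _) ContinuousLinearMap.norm_id_le)

open scoped ComplexOrder in
theorem spectrum_multHilbertOperator_subset :
    spectrum ℂ multHilbertOperator ⊆ (fun x : ℝ => (x : ℂ)) '' Icc 0 Real.pi := by
  intro z hz
  have hsa : IsSelfAdjoint multHilbertOperator := isPositive_multHilbertOperator.isSelfAdjoint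
  have hre := hsa.mem_spectrum_eq_re hz
  have hn : ‖z‖ ≤ Real.pi :=
    (norm_le_norm_multHilbertOperator hz).trans norm_multHilbertOperator_le
  have hnn : (0 : DirichletH20 →L[ℂ] DirichletH20) ≤ multHilbertOperator :=
    (ContinuousLinearMap.nonneg_iff_isPositive _).2 isPositive_multHilbertOperator
  have h0 : 0 ≤ z := spectrum_nonneg_of_nonneg hnn hz
  refine ⟨z.re, ⟨(Complex.le_def.1 h0).1, (Complex.re_le_norm z).trans hn⟩, hre.symm⟩

/-- The values `π / cosh (π β)` exhaust `(0, π]`, with `β` recovered through `arcosh`. The endpoint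
`0` follows because the spectrum is closed. -/
theorem subset_spectrum_multHilbertOperator :
    (fun x : ℝ => (x : ℂ)) '' Icc 0 Real.pi ⊆ spectrum ℂ multHilbertOperator := by
  have hpos : ∀ x : ℝ, 0 < x → x ≤ Real.pi → (x : ℂ) ∈ spectrum ℂ multHilbertOperator :=
    fun x h0 h1 => by
      have h2 : 1 ≤ Real.pi / x := (one_le_div h0).2 h1
      have h3 := pi_div_cosh_mem_spectrum (Real.arcosh (Real.pi / x) / Real.pi)
      rw [mul_div_cancel₀ _ Real.pi_pos.ne', Real.cosh_arcosh h2, div_div_cancel₀ Real.pi_pos.ne']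
        at h3
      exact h3
  rintro _ ⟨x, hx, rfl⟩
  rcases hx.1.eq_or_lt with h | h
  · have hcl : IsClosed (spectrum ℂ multHilbertOperator) := spectrum.isClosed _
    have ht : Filter.Tendsto (fun t : ℝ => (t : ℂ)) (nhdsWithin 0 (Ioi 0)) (nhds ((0 : ℝ) : ℂ)) :=
      (Complex.continuous_ofReal.tendsto 0).mono_left nhdsWithin_le_nhds
    subst h
    refine hcl.mem_of_tendsto ht ?_
    filter_upwards [Ioc_mem_nhdsGT Real.pi_pos] with t h
    exact hpos t h.1 h.2
  · exact hpos x h hx.2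

theorem injective_multHilbertOperator_sub (x : ℝ) (hx : x ∈ Icc 0 Real.pi) (f : DirichletH20)
    (hf : multHilbertOperator f = (x : ℂ) • f) : f = 0 := by
  rcases hx.1.eq_or_lt with h | h
  · by_contra hne
    have h1 := inner_multHilbertOperator_pos hne
    rw [hf, ← h] at h1
    simp at h1
  · exact eq_zero_of_multHilbertOperator_eq_smul h hx.2 hf

theorem not_hasEigenvalue_multHilbertOperator (z : ℂ) :
    ¬ Module.End.HasEigenvalue (multHilbertOperator : DirichletH20 →ₗ[ℂ] DirichletH20) z := by
  intro h
  obtain ⟨f, hf⟩ := h.exists_hasEigenvector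
  have hfz : multHilbertOperator f = z • f := hf.apply_eq_smul
  have hz : z ∈ spectrum ℂ multHilbertOperator := by
    intro hu
    obtain ⟨U, hU⟩ := hu
    have h1 : (↑U⁻¹ : DirichletH20 →L[ℂ] DirichletH20) * (U : DirichletH20 →L[ℂ] DirichletH20) = 1 :=
      U.inv_mul
    have h2 := congrArg (fun T : DirichletH20 →L[ℂ] DirichletH20 => T f) h1
    rw [hU] at h2
    simp [Algebra.algebraMap_eq_smul_one, hfz] at h2
    exact hf.2 h2.symm
  obtain ⟨x, hx, rfl⟩ := spectrum_multHilbertOperator_subset hz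
  exact hf.2 (injective_multHilbertOperator_sub x hx f hfz)

theorem continuousSpectrum_multHilbertOperator :
    continuousSpectrum multHilbertOperator = (fun x : ℝ => (x : ℂ)) '' Icc 0 Real.pi := by
  have hunit : ∀ z : ℂ, z ∈ spectrum ℂ multHilbertOperator ↔
      ¬ Function.Bijective (multHilbertOperator - z • ContinuousLinearMap.id ℂ DirichletH20) :=
    fun z => by
      rw [← ContinuousLinearMap.isUnit_iff_bijective, spectrum.mem_iff, ← IsUnit.neg_iff,
        neg_sub, Algebra.algebraMap_eq_smul_one]
      rfl
  apply Subset.antisymm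
  · rintro z ⟨-, -, hz⟩
    exact spectrum_multHilbertOperator_subset ((hunit z).2 fun h => hz h.2)
  · intro z hz
    have hspec := subset_spectrum_multHilbertOperator hz
    obtain ⟨x, hx, rfl⟩ := hz
    set S := multHilbertOperator - (x : ℂ) • ContinuousLinearMap.id ℂ DirichletH20 with hS
    have hker : ∀ f, S f = 0 → f = 0 := fun f hf => by
      refine injective_multHilbertOperator_sub x hx f ?_
      exact sub_eq_zero.1 (hf : multHilbertOperator f - (x : ℂ) • f = 0)
    have hinj : Function.Injective S := (injective_iff_map_eq_zero S).2 hker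
    have hadj : ContinuousLinearMap.adjoint S = S := by
      have h1 : ContinuousLinearMap.adjoint multHilbertOperator = multHilbertOperator :=
        isPositive_multHilbertOperator.isSelfAdjoint.adjoint_eq
      rw [hS, map_sub, h1, map_smulₛₗ, Complex.conj_ofReal, ContinuousLinearMap.adjoint_id]
    refine ⟨hinj, ?_, fun hsurj => (hunit _).1 hspec ⟨hinj, hsurj⟩⟩
    -- The orthogonal complement of the range is the kernel of the adjoint, and the adjoint is `S`
    -- itself because `x` is real. Injectivity therefore gives dense range.
    have h1 : (LinearMap.range (S : DirichletH20 →ₗ[ℂ] DirichletH20))ᗮ = ⊥ := by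
      rw [ContinuousLinearMap.orthogonal_range, hadj]
      exact LinearMap.ker_eq_bot.2 hinj
    have h2 := Submodule.topologicalClosure_eq_top_iff.2 h1
    exact (Submodule.dense_iff_topologicalClosure_eq_top.2 h2 :)

/-- The integral operator `H f(s) = ∫_{1/2}^∞ f(w) (ζ(w + s) - 1) dw` is well defined and bounded on
the space of Dirichlet series, its matrix is the multiplicative Hilbert matrix, it is strictly
positive with norm `π`, has no eigenvalues, and its spectrum is `[0, π]` and purely continuous. -/
theorem theorem1 :
    ∃ H : DirichletH20 →L[ℂ] DirichletH20,
      -- `H` is the integral operator, and the integral converges absolutely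
      (∀ (f : DirichletH20) (s : ℂ), 1 / 2 < s.re →
        IntegrableOn (zetaIntegrand f s) (Ioi (1 / 2 : ℝ)) ∧
        DirichletH20.eval (H f) s = ∫ w in Ioi (1 / 2 : ℝ), zetaIntegrand f s w) ∧
      -- `H` acts on coefficients as the multiplicative Hilbert matrix
      (∀ (f : DirichletH20) (m : IndexTwo),
        HasSum (fun n : IndexTwo => (multHilbertMatrix m n : ℂ) * f n) (H f m)) ∧
      -- `H` is strictly positive
      H.IsPositive ∧
      (∀ f : DirichletH20, f ≠ 0 → 0 < (⟪H f, f⟫_ℂ).re) ∧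
      -- the norm of `H`
      ‖H‖ = Real.pi ∧
      -- `H` has no eigenvalues
      (∀ z : ℂ, ¬ Module.End.HasEigenvalue (H : DirichletH20 →ₗ[ℂ] DirichletH20) z) ∧
      -- the spectrum of `H` is `[0, π]` and purely continuous
      spectrum ℂ H = (fun x : ℝ => (x : ℂ)) '' Icc 0 Real.pi ∧
      continuousSpectrum H = (fun x : ℝ => (x : ℂ)) '' Icc 0 Real.pi := by
  refine ⟨multHilbertOperator, fun f s hs => integrableOn_zetaIntegrand_and_eval_eq f hs,
    hasSum_multHilbertOperator, isPositive_multHilbertOperator,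
    fun f hf => inner_multHilbertOperator_pos hf, le_antisymm norm_multHilbertOperator_le ?_,
    not_hasEigenvalue_multHilbertOperator,
    spectrum_multHilbertOperator_subset.antisymm subset_spectrum_multHilbertOperator,
    continuousSpectrum_multHilbertOperator⟩
  -- The lower bound for the norm comes from the spectral point `π`.
  have h := norm_le_norm_multHilbertOperator
    (subset_spectrum_multHilbertOperator ⟨Real.pi, ⟨Real.pi_pos.le, le_rfl⟩, rfl⟩)
  rwa [Complex.norm_real, Real.norm_of_nonneg Real.pi_pos.le] at h
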